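/- Let $G$ be a discrete group. All rings are associative, possibly non-unital, equipped with a $G$-action by ring automorphisms, and quadratik (every element is a finite sum of products); ring homomorphisms are $G$-equivariant unless said otherwise. Compositions are written from left to right. A right functional module over a ring $(A,\alpha)$ is a right $A$-module $E$ with a compatible $G$-action $S$ and a $G$-invariant left $A$-submodule $\Theta_A(E)\subseteq \mathrm{Hom}_A(E,A)$; it is cofull if every $\xi\in E$ is a finite sum of elements $\zeta\,\phi(\eta)$ with $\zeta,\eta\in E$, $\phi\in\Theta_A(E)$. Its ring $\mathcal K_A(E)$ of compact operators consists of the finite sums of operators $\xi\mapsto\eta\,\phi(\xi)$, with $G$-action $T\mapsto S_gTS_{g^{-1}}$. $A$ itself is such a module, with the left multiplications by elements of $A$ as functionals. A corner embedding is, up to ring isomorphism, a map $e:A\to\mathcal K_A(E\oplus A\oplus\bigoplus_J A)$ acting by multiplication on the first coordinate $A$, where $E$ is a right functional module, $\bigoplus_J A$ carries an arbitrary $G$-action making it a right functional module, and the total module is cofull. Two ring homomorphisms $f_0,f_1:A\to B$ are homotopic if there is a ring homomorphism $F:A\to B\otimes_{\mathbb Z}C([0,1],\mathbb C)$ (trivial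 action on $C([0,1],\mathbb C)$) whose evaluations at $t=0,1$ in $B\otimes_{\mathbb Z}\mathbb C$ are $a\mapsto f_t(a)\otimes 1$. $GK^G$ is the category whose objects are these rings and whose morphisms are generated, under composition, addition and subtraction, by the ring homomorphisms, a morphism $e^{-1}:D\to A$ for every corner embedding $e:A\to D$, and a morphism $\Delta_s:M\to B$ for every split exact sequence $0\to B\xrightarrow{j}M\xrightarrow{f}A\to0$ with split $s:A\to M$, subject to the relations of a category enriched in abelian groups in which composition and units of ring homomorphisms are preserved, and to: $1_{A\oplus B}=p_Ai_A+p_Bi_B$; $f_0=f_1$ for homotopic $f_0,f_1$; $ee^{-1}=1$ and $e^{-1}e=1$; $1_B=j\Delta_s$ and $1_M=\Delta_sj+fs$. A double split exact sequence consists of a split exact sequence $0\to(B,\beta)\xrightarrow{j}(M,\gamma)\xrightarrow{f}(A,\alpha)\to0$ with split $s$, a second $G$-action $\delta$ on $M$, a ring homomorphism $t:(A,\alpha)\to(M,\delta)$ with $tf=\mathrm{id}_A$, and a $G$-action $\theta$ on $M_2(M)$ such that the corner embeddings $e_{11}:(M,\gamma)\to(M_2(M),\theta)$ and $e_{22}:(M,\delta)\to(M_2(M),\theta)$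 and the map $f\otimes1:(M_2(M),\theta)\to(M_2(A),\alpha\otimes1)$ are equivariant. An extended double split exact sequence is one together with a corner embedding $e:Z\to B$; its associated morphism is $t\,e_{22}\,e_{11}^{-1}\,\Delta_s\,e^{-1}\in GK^G(A,Z)$ (where $e_{11}$ is invertible in $GK^G$). A morphism is a term of $N$ extended double split exact sequences if it is of the form $\pm w_1\pm\dots\pm w_k$, $k\ge1$, where each $w_i$ is a product of at least one such associated morphism and the total number of factors, counted with repetition, is $N$. The level-$0$ morphisms $L_0GK^G(A,B)$ are the elements of the subgroup of $GK^G(A,B)$ generated by the ring homomorphisms $A\to B$. A morphism $P\in GK^G(B,D)$ is right-invertible if $PQ=1_B$ for some $Q\in GK^G(D,B)$. Lemma. Let $z\in GK^G(A,B)$ be a term of $N$ extended double split exact sequences. (i) There is a ring homomorphism $P:B\to D$, right-invertible in $GK^G$, such that $zP$ is a term of $N-1$ extended double split exact sequences if $N\ge2$, and such that $zP$ is a level-$0$ morphism if $N=1$. (ii) There is a ring homomorphism $P:B\to D$, right-invertible in $GK^G$, such that $zP\in L_0GK^G(A,D)$. -/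

import Mathlib

open CategoryTheory TensorProduct

universe u v

/-- A (not necessarily unital or commutative) ring is quadratik if each of its elements is a finite
sum of products. -/
def IsQuadratik (R : Type u) [NonUnitalRing R] : Prop :=
  ∀ a : R, a ∈ AddSubgroup.closure {x : R | ∃ b c : R, x = b * c}

/-- Quadratik `G`-rings. Since `G` is a group, a monoid homomorphism from `G` to the ring
endomorphisms is the same as a group homomorphism to the ring automorphisms. -/
structure GRing (G : Type v) [Group G] where
  carrier : Type u
  [ring : NonUnitalRing carrier]
  act : G →* (carrier →ₙ+* carrier)
  quadratik : IsQuadratik carrier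

namespace GRing

variable {G : Type v} [Group G]

instance : CoeSort (GRing.{u, v} G) (Type u) := ⟨GRing.carrier⟩

instance (A : GRing.{u, v} G) : NonUnitalRing A := A.ring

theorem act_one (A : GRing.{u, v} G) (a : A) : A.act 1 a = a := by simp

theorem act_mul (A : GRing.{u, v} G) (g h : G) (a : A) :
    A.act (g * h) a = A.act g (A.act h a) := by simp

/-- `G`-equivariant ring homomorphisms. -/
@[ext]
structure Hom (A B : GRing.{u, v} G) where
  toRingHom : A →ₙ+* B
  equivariant : ∀ (g : G) (a : A), toRingHom (A.act g a) = B.act g (toRingHom a)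

instance : Category (GRing.{u, v} G) where
  Hom := Hom
  id A := ⟨NonUnitalRingHom.id A, fun _ _ => rfl⟩
  comp f k := ⟨k.toRingHom.comp f.toRingHom, fun g a => by
    simp [f.equivariant, k.equivariant]⟩

instance {A B : GRing.{u, v} G} : CoeFun (A ⟶ B) (fun _ => A → B) :=
  ⟨fun f => Hom.toRingHom f⟩

/-- The same quadratik ring with another `G`-action. -/
abbrev withAction (A : GRing.{u, v} G) (δ : G →* (A →ₙ+* A)) : GRing.{u, v} G where
  carrier := A
  act := δ
  quadratik := A.quadratik

theorem mem_closure_single (R : Type u) [NonUnitalRing R] {x : R}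
    (hx : x ∈ AddSubgroup.closure {x : R | ∃ b c : R, x = b * c}) (i j : Fin 2) :
    Matrix.single i j x ∈ AddSubgroup.closure
      {X : Matrix (Fin 2) (Fin 2) R | ∃ Y Z : Matrix (Fin 2) (Fin 2) R, X = Y * Z} := by
  induction hx using AddSubgroup.closure_induction with
  | mem x hx =>
    obtain ⟨b, c, rfl⟩ := hx
    exact AddSubgroup.subset_closure
      ⟨Matrix.single i i b, Matrix.single i j c, by simp⟩
  | zero => simp
  | add x y _ _ h1 h2 => rw [Matrix.single_add]; exact add_mem h1 h2
  | neg x _ h =>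
    have : Matrix.single i j (-x) = -Matrix.single i j x := by
      ext a b; by_cases h : i = a ∧ j = b <;> simp [Matrix.single, h]
    rw [this]; exact neg_mem h

theorem isQuadratik_matrix (R : Type u) [NonUnitalRing R] (hR : IsQuadratik R) :
    IsQuadratik (Matrix (Fin 2) (Fin 2) R) := by
  intro X
  rw [Matrix.matrix_eq_sum_single X]
  exact sum_mem fun i _ => sum_mem fun j _ => mem_closure_single R (hR _) i j

/-- The ring of `2 × 2` matrices over `A`, with an arbitrary `G`-action `θ`. -/
abbrev mat (A : GRing.{u, v} G)
    (θ : G →* (Matrix (Fin 2) (Fin 2) A →ₙ+* Matrix (Fin 2) (Fin 2) A)) : GRing.{u, v} G where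
  carrier := Matrix (Fin 2) (Fin 2) A
  act := θ
  quadratik := isQuadratik_matrix A A.quadratik

theorem isQuadratik_prod {R S : Type u} [NonUnitalRing R] [NonUnitalRing S]
    (hR : IsQuadratik R) (hS : IsQuadratik S) : IsQuadratik (R × S) := by
  rintro ⟨r, s⟩
  have h1 : ((r, 0) : R × S) ∈ AddSubgroup.closure {x : R × S | ∃ b c : R × S, x = b * c} := by
    have := AddSubgroup.closure_le (K := (AddSubgroup.closure
      {x : R × S | ∃ b c : R × S, x = b * c}).comap (AddMonoidHom.inl R S)) |>.2 (by
        rintro _ ⟨b, c, rfl⟩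
        exact AddSubgroup.subset_closure ⟨(b, 0), (c, 0), by simp⟩) (hR r)
    simpa using this
  have h2 : ((0, s) : R × S) ∈ AddSubgroup.closure {x : R × S | ∃ b c : R × S, x = b * c} := by
    have := AddSubgroup.closure_le (K := (AddSubgroup.closure
      {x : R × S | ∃ b c : R × S, x = b * c}).comap (AddMonoidHom.inr R S)) |>.2 (by
        rintro _ ⟨b, c, rfl⟩
        exact AddSubgroup.subset_closure ⟨(0, b), (0, c), by simp⟩) (hS s)
    simpa using this
  simpa using add_mem h1 h2

/-- The direct sum `A ⊕ B` of `G`-rings. -/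
def prod (A B : GRing.{u, v} G) : GRing.{u, v} G where
  carrier := A × B
  act :=
    { toFun := fun g => NonUnitalRingHom.prodMap (A.act g) (B.act g)
      map_one' := by ext x <;> simp
      map_mul' := fun g h => by ext x <;> simp }
  quadratik := isQuadratik_prod A.quadratik B.quadratik

/-- The projection of `A ⊕ B` to `A`. -/
def fst (A B : GRing.{u, v} G) : A.prod B ⟶ A := ⟨NonUnitalRingHom.fst A B, fun _ _ => rfl⟩

/-- The projection of `A ⊕ B` to `B`. -/
def snd (A B : GRing.{u, v} G) : A.prod B ⟶ B := ⟨NonUnitalRingHom.snd A B, fun _ _ => rfl⟩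

/-- The injection of `A` into `A ⊕ B`. -/
def inl (A B : GRing.{u, v} G) : A ⟶ A.prod B :=
  ⟨{ AddMonoidHom.inl A B with
    map_mul' := fun _ _ => Prod.ext rfl (mul_zero (0 : B)).symm }, fun g _ => Prod.ext rfl (map_zero (B.act g)).symm⟩

/-- The injection of `B` into `A ⊕ B`. -/
def inr (A B : GRing.{u, v} G) : B ⟶ A.prod B :=
  ⟨{ AddMonoidHom.inr A B with
    map_mul' := fun _ _ => Prod.ext (mul_zero (0 : A)).symm rfl }, fun g _ => Prod.ext (map_zero (A.act g)).symm rfl⟩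

end GRing

/-- A right functional module over the `G`-ring `A`: a right `A`-module with a compatible
`G`-action and a distinguished `G`-invariant left `A`-submodule `functionals` of
`Hom_A(carrier, A)`. -/
structure FunctionalModule {G : Type v} [Group G] (A : GRing.{u, v} G) where
  carrier : Type u
  [addCommGroup : AddCommGroup carrier]
  smul : carrier →+ A →+ carrier
  smul_mul : ∀ (ξ : carrier) (a b : A), smul ξ (a * b) = smul (smul ξ a) b
  act : G → carrier →+ carrier
  act_one : ∀ ξ : carrier, act 1 ξ = ξ
  act_mul : ∀ (g h : G) (ξ : carrier), act (g * h) ξ = act g (act h ξ)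
  act_smul : ∀ (g : G) (ξ : carrier) (a : A), act g (smul ξ a) = smul (act g ξ) (A.act g a)
  functionals : AddSubgroup (carrier →+ A)
  map_smul : ∀ φ ∈ functionals, ∀ (ξ : carrier) (a : A), φ (smul ξ a) = φ ξ * a
  mul_mem : ∀ (a : A), ∀ φ ∈ functionals, (AddMonoidHom.mulLeft a).comp φ ∈ functionals
  conj_mem : ∀ (g : G), ∀ φ ∈ functionals,
    ((A.act g : A →+ A).comp φ).comp (act g⁻¹) ∈ functionals

namespace FunctionalModule

variable {G : Type v} [Group G] {A : GRing.{u, v} G}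

instance : CoeSort (FunctionalModule A) (Type u) := ⟨FunctionalModule.carrier⟩

instance (M : FunctionalModule A) : AddCommGroup M := M.addCommGroup

/-- The module is cofull: each element is a finite sum of elements `ζ φ(η)`. -/
def Cofull (M : FunctionalModule A) : Prop :=
  ∀ ξ : M, ξ ∈ AddSubgroup.closure {x : M | ∃ ζ η : M, ∃ φ ∈ M.functionals, x = M.smul ζ (φ η)}

/-- The elementary compact operator `ξ ↦ η φ(ξ)`. -/
def theta (M : FunctionalModule A) (η : M) (φ : M →+ A) : AddMonoid.End M := (M.smul η).comp φ

@[simp]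
theorem theta_apply (M : FunctionalModule A) (η : M) (φ : M →+ A) (ξ : M) :
    M.theta η φ ξ = M.smul η (φ ξ) := rfl

/-- The elementary compact operators. -/
def elementary (M : FunctionalModule A) : Set (AddMonoid.End M) :=
  {T | ∃ η : M, ∃ φ ∈ M.functionals, T = M.theta η φ}

theorem mul_mem_closure (M : FunctionalModule A) {S T : AddMonoid.End M}
    (hS : S ∈ AddSubgroup.closure M.elementary) (hT : T ∈ AddSubgroup.closure M.elementary) :
    S * T ∈ AddSubgroup.closure M.elementary := by
  induction hS using AddSubgroup.closure_induction with
  | zero => simp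
  | add x y _ _ h1 h2 => rw [add_mul]; exact add_mem h1 h2
  | neg x _ h => rw [neg_mul]; exact neg_mem h
  | mem S hS =>
    obtain ⟨η, φ, hφ, rfl⟩ := hS
    induction hT using AddSubgroup.closure_induction with
    | zero => simp
    | add x y _ _ h1 h2 => rw [mul_add]; exact add_mem h1 h2
    | neg x _ h => rw [mul_neg]; exact neg_mem h
    | mem T hT =>
      obtain ⟨ζ, ψ, hψ, rfl⟩ := hT
      refine AddSubgroup.subset_closure ⟨M.smul η (φ ζ), ψ, hψ, ?_⟩
      ext ξ
      simp [M.map_smul φ hφ, M.smul_mul]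

/-- The ring of compact operators: the finite sums of elementary compact operators. -/
def compact (M : FunctionalModule A) : NonUnitalSubring (AddMonoid.End M) where
  carrier := AddSubgroup.closure M.elementary
  add_mem' := add_mem
  zero_mem' := zero_mem _
  neg_mem' := neg_mem
  mul_mem' := M.mul_mem_closure

theorem mem_compact (M : FunctionalModule A) {T : AddMonoid.End M} :
    T ∈ M.compact ↔ T ∈ AddSubgroup.closure M.elementary := Iff.rfl

theorem act_inv_act (M : FunctionalModule A) (g : G) (ξ : M) : M.act g⁻¹ (M.act g ξ) = ξ := by
  rw [← M.act_mul, inv_mul_cancel, M.act_one]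

theorem act_act_inv (M : FunctionalModule A) (g : G) (ξ : M) : M.act g (M.act g⁻¹ ξ) = ξ := by
  have := M.act_inv_act g⁻¹ ξ
  rwa [inv_inv] at this

/-- The conjugation `T ↦ S_g ∘ T ∘ S_{g⁻¹}`, where `S` is the `G`-action on `M`. -/
def conj (M : FunctionalModule A) (g : G) : AddMonoid.End M →+ AddMonoid.End M :=
  AddMonoidHom.mk' (fun T => ((M.act g).comp T).comp (M.act g⁻¹)) fun S T => by
    ext ξ; exact map_add (M.act g) _ _

@[simp]
theorem conj_apply (M : FunctionalModule A) (g : G) (T : AddMonoid.End M) (ξ : M) :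
    M.conj g T ξ = M.act g (T (M.act g⁻¹ ξ)) := rfl

theorem conj_mem_compact (M : FunctionalModule A) (g : G) {T : AddMonoid.End M}
    (hT : T ∈ M.compact) : M.conj g T ∈ M.compact := by
  rw [mem_compact] at hT ⊢
  induction hT using AddSubgroup.closure_induction with
  | zero => simp
  | add x y _ _ h1 h2 => rw [map_add]; exact add_mem h1 h2
  | neg x _ h => rw [map_neg]; exact neg_mem h
  | mem T hT =>
    obtain ⟨η, φ, hφ, rfl⟩ := hT
    refine AddSubgroup.subset_closure ⟨M.act g η, _, M.conj_mem g φ hφ, ?_⟩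
    ext ξ
    exact M.act_smul g η _

theorem isQuadratik_compact (M : FunctionalModule A) (hM : M.Cofull) : IsQuadratik M.compact := by
  have key : ∀ (ψ : M →+ A) (hψ : ψ ∈ M.functionals) (ξ : M),
      (⟨M.theta ξ ψ, AddSubgroup.subset_closure ⟨ξ, ψ, hψ, rfl⟩⟩ : M.compact) ∈
        AddSubgroup.closure {x : M.compact | ∃ b c : M.compact, x = b * c} := by
    intro ψ hψ ξ
    let L : M →+ M.compact := AddMonoidHom.mk'
      (fun ξ => ⟨M.theta ξ ψ, AddSubgroup.subset_closure ⟨ξ, ψ, hψ, rfl⟩⟩)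
      (fun x y => Subtype.ext (AddMonoidHom.ext fun ζ => by
        change M.smul (x + y) (ψ ζ) = M.smul x (ψ ζ) + M.smul y (ψ ζ)
        simp))
    refine AddSubgroup.closure_le (K := (AddSubgroup.closure
      {x : M.compact | ∃ b c : M.compact, x = b * c}).comap L) |>.2 ?_ (hM ξ)
    rintro _ ⟨ζ, η, φ, hφ, rfl⟩
    refine AddSubgroup.subset_closure
      ⟨⟨M.theta ζ φ, AddSubgroup.subset_closure ⟨ζ, φ, hφ, rfl⟩⟩,
        ⟨M.theta η ψ, AddSubgroup.subset_closure ⟨η, ψ, hψ, rfl⟩⟩,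
        Subtype.ext (AddMonoidHom.ext fun χ => ?_)⟩
    change M.smul (M.smul ζ (φ η)) (ψ χ) = M.smul ζ (φ (M.smul η (ψ χ)))
    rw [M.map_smul φ hφ, M.smul_mul]
  have gen : ∀ (T : AddMonoid.End M) (hT : T ∈ AddSubgroup.closure M.elementary),
      (⟨T, hT⟩ : M.compact) ∈
        AddSubgroup.closure {x : M.compact | ∃ b c : M.compact, x = b * c} := by
    intro T hT
    induction hT using AddSubgroup.closure_induction with
    | zero => exact zero_mem _
    | add x y hx hy h1 h2 => exact add_mem h1 h2
    | neg x hx h => exact neg_mem h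
    | mem x hx =>
      obtain ⟨η, φ, hφ, rfl⟩ := hx
      exact key φ hφ η
  exact fun T => gen T.1 T.2

/-- The `G`-ring `K_A(M)` of compact operators on a cofull module `M`; the action is
`T ↦ S_g ∘ T ∘ S_{g⁻¹}`, where `S` is the action on `M`. -/
def compactRing (M : FunctionalModule A) (hM : M.Cofull) : GRing.{u, v} G where
  carrier := M.compact
  act :=
    { toFun := fun g =>
        { toFun := fun T => ⟨M.conj g T, M.conj_mem_compact g T.2⟩
          map_zero' := Subtype.ext (map_zero (M.conj g))
          map_add' := fun S T => Subtype.ext (map_add (M.conj g) S.1 T.1)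
          map_mul' := fun S T => Subtype.ext (AddMonoidHom.ext fun ξ => by
            change M.act g (S.1 (T.1 (M.act g⁻¹ ξ))) =
              M.act g (S.1 (M.act g⁻¹ (M.act g (T.1 (M.act g⁻¹ ξ)))))
            rw [act_inv_act]) }
      map_one' := NonUnitalRingHom.ext fun T => Subtype.ext (AddMonoidHom.ext fun ξ => by
        change M.act 1 (T.1 (M.act 1⁻¹ ξ)) = T.1 ξ
        rw [inv_one, M.act_one, M.act_one])
      map_mul' := fun g h => NonUnitalRingHom.ext fun T =>
        Subtype.ext (AddMonoidHom.ext fun ξ => by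
          change M.act (g * h) (T.1 (M.act (g * h)⁻¹ ξ)) =
            M.act g (M.act h (T.1 (M.act h⁻¹ (M.act g⁻¹ ξ))))
          rw [mul_inv_rev, M.act_mul, M.act_mul]) }
  quadratik := M.isQuadratik_compact hM

/-- The direct sum of two right functional modules. Its functionals are the maps
`(ξ, η) ↦ φ(ξ) + ψ(η)`. -/
abbrev prod (M N : FunctionalModule A) : FunctionalModule A where
  carrier := M × N
  smul := AddMonoidHom.mk' (fun x => (M.smul x.1).prod (N.smul x.2)) (fun x y => by
    ext a <;> simp)
  smul_mul x a b := by simp [M.smul_mul, N.smul_mul]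
  act g := AddMonoidHom.prodMap (M.act g) (N.act g)
  act_one x := Prod.ext (M.act_one _) (N.act_one _)
  act_mul g h x := Prod.ext (M.act_mul _ _ _) (N.act_mul _ _ _)
  act_smul g x a := by simp [M.act_smul, N.act_smul]
  functionals :=
    { carrier := {χ | ∃ φ ∈ M.functionals, ∃ ψ ∈ N.functionals, χ = AddMonoidHom.coprod φ ψ}
      zero_mem' := ⟨0, zero_mem _, 0, zero_mem _, AddMonoidHom.ext fun _ => (add_zero 0).symm⟩
      add_mem' := by
        rintro _ _ ⟨φ, hφ, ψ, hψ, rfl⟩ ⟨φ', hφ', ψ', hψ', rfl⟩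
        refine ⟨φ + φ', add_mem hφ hφ', ψ + ψ', add_mem hψ hψ', AddMonoidHom.ext fun x => ?_⟩
        simp only [AddMonoidHom.add_apply, AddMonoidHom.coprod_apply]
        abel
      neg_mem' := by
        rintro _ ⟨φ, hφ, ψ, hψ, rfl⟩
        refine ⟨-φ, neg_mem hφ, -ψ, neg_mem hψ, AddMonoidHom.ext fun x => ?_⟩
        simp only [AddMonoidHom.neg_apply, AddMonoidHom.coprod_apply]
        abel }
  map_smul := by
    rintro _ ⟨φ, hφ, ψ, hψ, rfl⟩ x a
    simp [M.map_smul φ hφ, N.map_smul ψ hψ, add_mul]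
  mul_mem := by
    rintro a _ ⟨φ, hφ, ψ, hψ, rfl⟩
    exact ⟨_, M.mul_mem a φ hφ, _, N.mul_mem a ψ hψ,
      AddMonoidHom.ext fun x => mul_add a (φ x.1) (ψ x.2)⟩
  conj_mem := by
    rintro g _ ⟨φ, hφ, ψ, hψ, rfl⟩
    exact ⟨_, M.conj_mem g φ hφ, _, N.conj_mem g ψ hψ,
      AddMonoidHom.ext fun x => map_add (A.act g) (φ _) (ψ _)⟩

/-- The `G`-ring `A` as a right functional module over itself; the functionals are the left
multiplications by elements of `A`. -/
abbrev self (A : GRing.{u, v} G) : FunctionalModule A where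
  carrier := A
  smul := AddMonoidHom.mul
  smul_mul a b c := by simp [mul_assoc]
  act g := (A.act g : A →+ A)
  act_one := A.act_one
  act_mul := A.act_mul
  act_smul g a b := by simp
  functionals := AddMonoidHom.range (AddMonoidHom.mul (R := A))
  map_smul := by
    rintro _ ⟨b, rfl⟩ a c
    simp [mul_assoc]
  mul_mem := by
    rintro a _ ⟨b, rfl⟩
    exact ⟨a * b, by ext x; simp [mul_assoc]⟩
  conj_mem := by
    rintro g _ ⟨b, rfl⟩
    refine ⟨A.act g b, AddMonoidHom.ext fun x => ?_⟩
    change A.act g b * x = A.act g (b * A.act g⁻¹ x)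
    rw [map_mul, ← GRing.act_mul, mul_inv_cancel, GRing.act_one]

/-- A `G`-action on the right functional module `⨁_J A`, the direct sum of copies of `A`; it need
not be diagonal. A functional on `⨁_J A` is given by left multiplication by an element of `A` on
each coordinate, and the space of functionals is `G`-invariant. -/
structure FreeAction (A : GRing.{u, v} G) (J : Type u) where
  act : G → (J →₀ A) →+ (J →₀ A)
  act_one : ∀ x, act 1 x = x
  act_mul : ∀ (g h : G) (x : J →₀ A), act (g * h) x = act g (act h x)
  act_smul : ∀ (g : G) (x : J →₀ A) (a : A),
    act g (x.mapRange (· * a) (zero_mul a)) =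
      (act g x).mapRange (· * A.act g a) (zero_mul _)
  conj_mem : ∀ (g : G) (φ : (J →₀ A) →+ A),
    (∀ j, ∃ b : A, ∀ a : A, φ (Finsupp.single j a) = b * a) →
    ∀ j, ∃ b : A, ∀ a : A, A.act g (φ (act g⁻¹ (Finsupp.single j a))) = b * a

/-- The right functional module `⨁_J A` with the `G`-action `T`. -/
noncomputable abbrev free (A : GRing.{u, v} G) (J : Type u) (T : FreeAction A J) :
    FunctionalModule A where
  carrier := J →₀ A
  smul := AddMonoidHom.mk' (fun x => AddMonoidHom.mk' (fun a => x.mapRange (· * a) (zero_mul a))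
      (fun a b => by ext j; simp [mul_add])) (fun x y => by ext a j; simp [add_mul])
  smul_mul x a b := by
    ext j; exact (mul_assoc _ _ _).symm
  act := T.act
  act_one := T.act_one
  act_mul := T.act_mul
  act_smul := T.act_smul
  functionals :=
    { carrier := {φ | ∀ j, ∃ b : A, ∀ a : A, φ (Finsupp.single j a) = b * a}
      zero_mem' := fun j => ⟨0, by simp⟩
      add_mem' := fun {φ ψ} hφ hψ j => by
        obtain ⟨b, hb⟩ := hφ j
        obtain ⟨c, hc⟩ := hψ j
        exact ⟨b + c, fun a => by simp [hb, hc, add_mul]⟩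
      neg_mem' := fun {φ} hφ j => by
        obtain ⟨b, hb⟩ := hφ j
        exact ⟨-b, fun a => by simp [hb]⟩ }
  map_smul φ hφ x a := by
    induction x using Finsupp.induction_linear with
    | zero => simp
    | add x y hx hy => rw [map_add, AddMonoidHom.add_apply, map_add, hx, hy, map_add, add_mul]
    | single j c =>
      obtain ⟨b, hb⟩ := hφ j
      change φ ((Finsupp.single j c).mapRange (· * a) (zero_mul a)) = _
      rw [Finsupp.mapRange_single, hb, hb, mul_assoc]
  mul_mem a φ hφ j := by
    obtain ⟨b, hb⟩ := hφ j
    exact ⟨a * b, fun c => by simp [hb, mul_assoc]⟩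
  conj_mem := T.conj_mem

end FunctionalModule

/-- `f : A ⟶ D` is a corner embedding: up to an isomorphism of `G`-rings it is the map
`e : A ⟶ K_A(E ⊕ H_A)`, `e(a)(ξ, b, η) = (0, ab, 0)`, where `E` is a right functional `A`-module,
`H_A = A ⊕ ⨁_J A` (the first summand, with the given action of `A`, is the distinguished
coordinate, and the `G`-action `T` on `⨁_J A` is arbitrary), and `E ⊕ H_A` is cofull. -/
def IsCornerEmbedding {G : Type v} [Group G] {A D : GRing.{u, v} G} (f : A ⟶ D) : Prop :=
  ∃ (E : FunctionalModule A) (J : Type u) (T : FunctionalModule.FreeAction A J)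
    (hcof : (E.prod ((FunctionalModule.self A).prod (FunctionalModule.free A J T))).Cofull)
    (κ : D ≅ FunctionalModule.compactRing _ hcof),
    ∀ (a : A) (ξ : E) (b : A) (η : J →₀ A),
      ((κ.hom (f a)).1 : AddMonoid.End (E × (A × (J →₀ A)))) (ξ, (b, η)) = (0, (a * b, 0))

/-- A split exact sequence `0 → B → M → A → 0` of `G`-rings with inclusion `j`, quotient map `f` and
split `s`. -/
structure SplitExact {G : Type v} [Group G] (B M A : GRing.{u, v} G) where
  j : B ⟶ M
  f : M ⟶ A
  s : A ⟶ M
  injective : Function.Injective j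
  exact : ∀ m : M, f m = 0 ↔ ∃ b : B, j b = m
  split : s ≫ f = 𝟙 A

/-- Evaluation `B ⊗ C[0,1] → B ⊗ ℂ` at `t`. -/
noncomputable def evalTensor (B : Type u) [NonUnitalRing B] (t : unitInterval) :
    B ⊗[ℤ] C(unitInterval, ℂ) →ₗ[ℤ] B ⊗[ℤ] ℂ :=
  LinearMap.lTensor B (ContinuousMap.evalAlgHom ℤ ℂ t).toLinearMap

/-- The action of `g` on `B ⊗ C[0,1]`, trivial on `C[0,1]`. -/
noncomputable def tensorAct {G : Type v} [Group G] (B : GRing.{u, v} G) (g : G) :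
    B ⊗[ℤ] C(unitInterval, ℂ) →ₗ[ℤ] B ⊗[ℤ] C(unitInterval, ℂ) :=
  LinearMap.rTensor _ (AddMonoidHom.toIntLinearMap (B.act g : B →+ B))

/-- `f₀, f₁ : A ⟶ B` are the ends of a homotopy `F : A → B ⊗ C[0,1]`, an equivariant ring
homomorphism. Its values at the ends `0`, `1` lie in `B ⊗ ℤ` inside `B ⊗ ℂ`, that is, they have the
form `b ⊗ 1`. -/
def Homotopic {G : Type v} [Group G] {A B : GRing.{u, v} G} (f₀ f₁ : A ⟶ B) : Prop :=
  ∃ F : A →ₙ+* (B ⊗[ℤ] C(unitInterval, ℂ)),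
    (∀ (g : G) (a : A), F (A.act g a) = tensorAct B g (F a)) ∧
    (∀ a : A, evalTensor B 0 (F a) = f₀ a ⊗ₜ[ℤ] (1 : ℂ)) ∧
    (∀ a : A, evalTensor B 1 (F a) = f₁ a ⊗ₜ[ℤ] (1 : ℂ))

/-! ### The category `GK^G` -/

/-- Formal expressions in the generators: ring homomorphisms, formal inverses of corner embeddings,
and formal splits `M → B` of split exact sequences, closed under composition (written from left to
right), addition and subtraction. -/
inductive GKExpr {G : Type v} [Group G] :
    GRing.{u, v} G → GRing.{u, v} G → Type (max (u + 1) v)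
  | hom {A B : GRing.{u, v} G} (f : A ⟶ B) : GKExpr A B
  | cornerInv {A D : GRing.{u, v} G} (e : A ⟶ D) (he : IsCornerEmbedding e) : GKExpr D A
  | delta {B M A : GRing.{u, v} G} (S : SplitExact B M A) : GKExpr M B
  | comp {A B C : GRing.{u, v} G} (x : GKExpr A B) (y : GKExpr B C) : GKExpr A C
  | zero (A B : GRing.{u, v} G) : GKExpr A B
  | add {A B : GRing.{u, v} G} (x y : GKExpr A B) : GKExpr A B
  | neg {A B : GRing.{u, v} G} (x : GKExpr A B) : GKExpr A B

open GKExpr in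
/-- The congruence on formal expressions that defines `GK^G`. -/
inductive GKRel {G : Type v} [Group G] :
    ∀ {A B : GRing.{u, v} G}, GKExpr A B → GKExpr A B → Prop
  -- equivalence relation and congruence
  | refl {A B : GRing.{u, v} G} (x : GKExpr A B) : GKRel x x
  | symm {A B : GRing.{u, v} G} {x y : GKExpr A B} : GKRel x y → GKRel y x
  | trans {A B : GRing.{u, v} G} {x y z : GKExpr A B} : GKRel x y → GKRel y z → GKRel x z
  | comp_congr {A B C : GRing.{u, v} G} {x x' : GKExpr A B} {y y' : GKExpr B C} :
      GKRel x x' → GKRel y y' → GKRel (comp x y) (comp x' y')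
  | add_congr {A B : GRing.{u, v} G} {x x' y y' : GKExpr A B} :
      GKRel x x' → GKRel y y' → GKRel (add x y) (add x' y')
  | neg_congr {A B : GRing.{u, v} G} {x x' : GKExpr A B} : GKRel x x' → GKRel (neg x) (neg x')
  -- preadditive category
  | comp_assoc {A B C D : GRing.{u, v} G} (x : GKExpr A B) (y : GKExpr B C) (z : GKExpr C D) :
      GKRel (comp (comp x y) z) (comp x (comp y z))
  | id_comp {A B : GRing.{u, v} G} (x : GKExpr A B) : GKRel (comp (hom (𝟙 A)) x) x
  | comp_id {A B : GRing.{u, v} G} (x : GKExpr A B) : GKRel (comp x (hom (𝟙 B))) x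
  | add_assoc {A B : GRing.{u, v} G} (x y z : GKExpr A B) :
      GKRel (add (add x y) z) (add x (add y z))
  | add_comm {A B : GRing.{u, v} G} (x y : GKExpr A B) : GKRel (add x y) (add y x)
  | zero_add {A B : GRing.{u, v} G} (x : GKExpr A B) : GKRel (add (zero A B) x) x
  | neg_add {A B : GRing.{u, v} G} (x : GKExpr A B) : GKRel (add (neg x) x) (zero A B)
  | comp_add {A B C : GRing.{u, v} G} (x : GKExpr A B) (y z : GKExpr B C) :
      GKRel (comp x (add y z)) (add (comp x y) (comp x z))
  | add_comp {A B C : GRing.{u, v} G} (x y : GKExpr A B) (z : GKExpr B C) :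
      GKRel (comp (add x y) z) (add (comp x z) (comp y z))
  -- composition of ring homomorphisms
  | hom_comp {A B C : GRing.{u, v} G} (f : A ⟶ B) (k : B ⟶ C) :
      GKRel (comp (hom f) (hom k)) (hom (f ≫ k))
  -- additivity
  | biproduct (A B : GRing.{u, v} G) :
      GKRel (hom (𝟙 (A.prod B)))
        (add (comp (hom (A.fst B)) (hom (A.inl B))) (comp (hom (A.snd B)) (hom (A.inr B))))
  -- homotopy invariance
  | homotopy {A B : GRing.{u, v} G} (f₀ f₁ : A ⟶ B) : Homotopic f₀ f₁ → GKRel (hom f₀) (hom f₁)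
  -- stability
  | corner_inv {A D : GRing.{u, v} G} (e : A ⟶ D) (he : IsCornerEmbedding e) :
      GKRel (comp (hom e) (cornerInv e he)) (hom (𝟙 A))
  | inv_corner {A D : GRing.{u, v} G} (e : A ⟶ D) (he : IsCornerEmbedding e) :
      GKRel (comp (cornerInv e he) (hom e)) (hom (𝟙 D))
  -- split exactness
  | j_delta {B M A : GRing.{u, v} G} (S : SplitExact B M A) :
      GKRel (comp (hom S.j) (delta S)) (hom (𝟙 B))
  | delta_j {B M A : GRing.{u, v} G} (S : SplitExact B M A) :
      GKRel (hom (𝟙 M)) (add (comp (delta S) (hom S.j)) (comp (hom S.f) (hom S.s)))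

/-- Objects of `GK^G`: the quadratik `G`-rings. -/
structure GK (G : Type v) [Group G] where
  ring : GRing.{u, v} G

namespace GK

variable {G : Type v} [Group G]

/-- Morphisms of `GK^G`: classes of formal expressions. -/
def Hom (A B : GRing.{u, v} G) : Type (max (u + 1) v) := Quot (GKRel (A := A) (B := B))

/-- Composition in `GK^G`. -/
def Hom.comp {A B C : GRing.{u, v} G} : Hom A B → Hom B C → Hom A C :=
  Quot.map₂ GKExpr.comp (fun x _ _ h => .comp_congr (.refl x) h)
    (fun _ _ y h => .comp_congr h (.refl y))

instance (A B : GRing.{u, v} G) : Add (Hom A B) :=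
  ⟨Quot.map₂ GKExpr.add (fun x _ _ h => .add_congr (.refl x) h)
    (fun _ _ y h => .add_congr h (.refl y))⟩

instance (A B : GRing.{u, v} G) : Zero (Hom A B) := ⟨Quot.mk _ (.zero A B)⟩

instance (A B : GRing.{u, v} G) : Neg (Hom A B) := ⟨Quot.map GKExpr.neg fun _ _ => .neg_congr⟩

instance (A B : GRing.{u, v} G) : AddCommGroup (Hom A B) where
  add_assoc := by rintro ⟨x⟩ ⟨y⟩ ⟨z⟩; exact Quot.sound (.add_assoc x y z)
  zero_add := by rintro ⟨x⟩; exact Quot.sound (.zero_add x)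
  add_zero := by rintro ⟨x⟩; exact Quot.sound ((GKRel.add_comm _ _).trans (.zero_add x))
  add_comm := by rintro ⟨x⟩ ⟨y⟩; exact Quot.sound (.add_comm x y)
  neg_add_cancel := by rintro ⟨x⟩; exact Quot.sound (.neg_add x)
  nsmul := nsmulRec
  zsmul := zsmulRec

instance : Category (GK.{u, v} G) where
  Hom A B := Hom A.ring B.ring
  id A := Quot.mk _ (.hom (𝟙 A.ring))
  comp := Hom.comp
  id_comp := by rintro A B ⟨x⟩; exact Quot.sound (.id_comp x)
  comp_id := by rintro A B ⟨x⟩; exact Quot.sound (.comp_id x)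
  assoc := by rintro A B C D ⟨x⟩ ⟨y⟩ ⟨z⟩; exact Quot.sound (.comp_assoc x y z)

instance : Preadditive (GK.{u, v} G) where
  homGroup A B := inferInstanceAs (AddCommGroup (Hom A.ring B.ring))
  add_comp := by rintro A B C ⟨x⟩ ⟨y⟩ ⟨z⟩; exact Quot.sound (.add_comp x y z)
  comp_add := by rintro A B C ⟨x⟩ ⟨y⟩ ⟨z⟩; exact Quot.sound (.comp_add x y z)

/-- The canonical functor from quadratik `G`-rings and equivariant ring homomorphisms to `GK^G`. -/
def ι (G : Type v) [Group G] : GRing.{u, v} G ⥤ GK.{u, v} G where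
  obj A := ⟨A⟩
  map f := Quot.mk _ (.hom f)
  map_id _ := rfl
  map_comp f k := (Quot.sound (.hom_comp f k)).symm

/-- The synthetical split `Δ_S : M → B` of a split exact sequence `S`. -/
def Δ {B M A : GRing.{u, v} G} (S : SplitExact B M A) : (ι G).obj M ⟶ (ι G).obj B :=
  Quot.mk _ (.delta S)

/-- The inverse `e⁻¹ : D → A` of a corner embedding `e : A → D`. -/
def cornerInv {A D : GRing.{u, v} G} (e : A ⟶ D) (he : IsCornerEmbedding e) :
    (ι G).obj D ⟶ (ι G).obj A :=
  Quot.mk _ (.cornerInv e he)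

/-- Corner embeddings are invertible in `GK^G`. -/
theorem isIso_corner {A D : GRing.{u, v} G} {e : A ⟶ D} (he : IsCornerEmbedding e) :
    IsIso ((ι G).map e) :=
  ⟨cornerInv e he, Quot.sound (.corner_inv e he), Quot.sound (.inv_corner e he)⟩

end GK

/-! ### Invertibility of the matrix corner embedding `e₁₁` in `GK^G` -/

namespace FunctionalModule

variable {G : Type v} [Group G]

/-- The unique action on the zero module. -/
noncomputable def zeroAction (A : GRing.{u, v} G) : FreeAction A PEmpty.{u + 1} where
  act _ := 0
  act_one _ := Subsingleton.elim _ _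
  act_mul _ _ _ := Subsingleton.elim _ _
  act_smul _ _ _ := Subsingleton.elim _ _
  conj_mem _ _ _ j := j.elim

/-- The zero module. -/
noncomputable abbrev zeroModule (A : GRing.{u, v} G) : FunctionalModule A :=
  free A PEmpty.{u + 1} (zeroAction A)

instance (A : GRing.{u, v} G) : Subsingleton (zeroModule A) :=
  inferInstanceAs (Subsingleton (PEmpty.{u + 1} →₀ A))

theorem zero_mem_functionals (A : GRing.{u, v} G) (φ : zeroModule A →+ A) :
    φ ∈ (zeroModule A).functionals := fun j => PEmpty.elim j

/-- The module `E ⊕ A`, written as `E ⊕ (A ⊕ 0)`. -/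
noncomputable abbrev cornerModule {A : GRing.{u, v} G} (E : FunctionalModule A) :
    FunctionalModule A :=
  E.prod ((self A).prod (zeroModule A))

theorem mem_functionals_cornerModule {A : GRing.{u, v} G} (E : FunctionalModule A)
    (χ : cornerModule E →+ A) : χ ∈ (cornerModule E).functionals ↔
      ∃ φ ∈ E.functionals, ∃ c : A, ∀ (ξ : E) (b : A) (η : zeroModule A),
        χ (ξ, (b, η)) = φ ξ + c * b := by
  constructor
  · rintro ⟨φ, hφ, _, ⟨_, ⟨c, rfl⟩, ψ, -, rfl⟩, rfl⟩
    refine ⟨φ, hφ, c, fun ξ b η => ?_⟩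
    rw [Subsingleton.elim η 0]
    change φ ξ + (c * b + ψ 0) = φ ξ + c * b
    rw [map_zero, add_zero]
  · rintro ⟨φ, hφ, c, h⟩
    refine ⟨φ, hφ, _, ⟨_, ⟨c, rfl⟩, 0, zero_mem_functionals A _, rfl⟩, ?_⟩
    refine AddMonoidHom.ext fun x => ?_
    refine (h x.1 x.2.1 x.2.2).trans ?_
    change φ x.1 + c * x.2.1 = φ x.1 + (c * x.2.1 + 0)
    rw [add_zero]

theorem cofull_cornerModule {A : GRing.{u, v} G} (E : FunctionalModule A)
    (hE : ∀ ξ : E, ξ ∈ AddSubgroup.closure {x : E | ∃ (ζ : E) (a : A), x = E.smul ζ a}) :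
    (cornerModule E).Cofull := by
  set K := AddSubgroup.closure {x : cornerModule E | ∃ ζ η : cornerModule E,
    ∃ φ ∈ (cornerModule E).functionals, x = (cornerModule E).smul ζ (φ η)} with hK
  have aux : ∀ (ζ : cornerModule E) (a : A), (cornerModule E).smul ζ a ∈ K := by
    intro ζ a
    refine AddSubgroup.closure_le (K := K.comap ((cornerModule E).smul ζ)) |>.2 ?_ (A.quadratik a)
    rintro _ ⟨b, c, rfl⟩
    refine AddSubgroup.subset_closure ⟨ζ, ((0 : E), ((c : A), (0 : zeroModule A))),
      AddMonoidHom.mk' (fun x => b * x.2.1) (fun x y => mul_add b x.2.1 y.2.1), ?_, rfl⟩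
    rw [mem_functionals_cornerModule]
    exact ⟨0, zero_mem _, b, fun ξ x η => by simp⟩
  intro x
  have h1 : ((x.1, ((0 : A), (0 : zeroModule A))) : cornerModule E) ∈ K := by
    refine AddSubgroup.closure_le (K := K.comap
      (AddMonoidHom.inl E ((self A).prod (zeroModule A)))) |>.2 ?_ (hE x.1)
    rintro _ ⟨ζ, a, rfl⟩
    refine (?_ : ((E.smul ζ a, ((0 : A), (0 : zeroModule A))) : cornerModule E) ∈ K)
    convert aux (ζ, ((0 : A), (0 : zeroModule A))) a using 1
    exact Prod.ext rfl (Prod.ext (zero_mul a).symm (Subsingleton.elim _ _))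
  have h2 : (((0 : E), (x.2.1, (0 : zeroModule A))) : cornerModule E) ∈ K := by
    refine AddSubgroup.closure_le (K := K.comap
      ((AddMonoidHom.inr E ((self A).prod (zeroModule A))).comp
        (AddMonoidHom.inl A (zeroModule A)))) |>.2 ?_ (A.quadratik x.2.1)
    rintro _ ⟨b, c, rfl⟩
    refine (?_ : (((0 : E), ((b * c : A), (0 : zeroModule A))) : cornerModule E) ∈ K)
    convert aux ((0 : E), ((b : A), (0 : zeroModule A))) c using 1
    refine Prod.ext ?_ (Prod.ext rfl (Subsingleton.elim _ _))
    change 0 = E.smul 0 c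
    simp
  have := add_mem h1 h2
  convert this using 1
  exact Prod.ext (add_zero x.1).symm (Prod.ext (zero_add x.2.1).symm (Subsingleton.elim _ _))

end FunctionalModule

namespace GRing

variable {G : Type v} [Group G]

@[simp]
theorem comp_apply {A B C : GRing.{u, v} G} (f : A ⟶ B) (k : B ⟶ C) (a : A) :
    (f ≫ k) a = k (f a) := rfl

theorem hom_ext {A B : GRing.{u, v} G} {f k : A ⟶ B} (h : ∀ a : A, f a = k a) : f = k :=
  Hom.ext (NonUnitalRingHom.ext h)

theorem exists_fac {D K L : GRing.{u, v} G} (q : D ⟶ K) (hq : Function.Surjective q)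
    (l : D ⟶ L) (h : ∀ X : D, q X = 0 → l X = 0) : ∃ k : K ⟶ L, q ≫ k = l := by
  have h' : ∀ X Y : D, q X = q Y → l X = l Y := fun X Y e => by
    have := h (X - Y) (by rw [map_sub, e, sub_self])
    rwa [map_sub, sub_eq_zero] at this
  have hl : ∀ X : D, l (Function.surjInv hq (q X)) = l X := fun X =>
    h' _ _ (Function.surjInv_eq hq _)
  refine ⟨⟨{ toFun := fun x => l (Function.surjInv hq x)
             map_zero' := ?_, map_add' := ?_, map_mul' := ?_ }, ?_⟩, hom_ext hl⟩
  · intro x y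
    obtain ⟨x, rfl⟩ := hq x
    obtain ⟨y, rfl⟩ := hq y
    rw [← map_mul, hl, hl, hl, map_mul]
  · rw [← map_zero (Hom.toRingHom q), hl, map_zero]
  · intro x y
    obtain ⟨x, rfl⟩ := hq x
    obtain ⟨y, rfl⟩ := hq y
    rw [← map_add, hl, hl, hl, map_add]
  · intro g x
    obtain ⟨x, rfl⟩ := hq x
    change l (Function.surjInv hq (K.act g (q x))) = L.act g (l (Function.surjInv hq (q x)))
    rw [← q.equivariant, hl, hl, l.equivariant]

theorem exists_iso {D K L : GRing.{u, v} G} (q : D ⟶ K) (hq : Function.Surjective q)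
    (l : D ⟶ L) (hl : Function.Surjective l) (h : ∀ X : D, q X = 0 ↔ l X = 0) :
    ∃ κ : K ≅ L, q ≫ κ.hom = l := by
  obtain ⟨k, hk⟩ := exists_fac q hq l fun X => (h X).1
  obtain ⟨k', hk'⟩ := exists_fac l hl q fun X => (h X).2
  have e1 : ∀ X : D, k (q X) = l X := fun X => by rw [← hk]; rfl
  have e2 : ∀ X : D, k' (l X) = q X := fun X => by rw [← hk']; rfl
  refine ⟨⟨k, k', hom_ext fun x => ?_, hom_ext fun x => ?_⟩, hk⟩
  · obtain ⟨X, rfl⟩ := hq x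
    change k' (k (q X)) = q X
    rw [e1, e2]
  · obtain ⟨X, rfl⟩ := hl x
    change k (k' (l X)) = l X
    rw [e2, e1]

end GRing

open FunctionalModule

/-- Left multiplication on the coordinate `A`. -/
noncomputable def leftMul {G : Type v} [Group G] {A : GRing.{u, v} G} (E : FunctionalModule A) :
    A →+ AddMonoid.End (cornerModule E) :=
  AddMonoidHom.mk' (fun a => AddMonoidHom.mk'
      (fun x => (((0 : E), ((a * x.2.1 : A), (0 : zeroModule A))) : cornerModule E))
      (fun x y => Prod.ext (add_zero 0).symm
        (Prod.ext (mul_add a x.2.1 y.2.1) (add_zero 0).symm)))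
    (fun a b => AddMonoidHom.ext fun x => Prod.ext (add_zero 0).symm
        (Prod.ext (add_mul a b x.2.1) (add_zero 0).symm))

theorem isCornerEmbedding_of_surjective {G : Type v} [Group G] {D K : GRing.{u, v} G} (q : D ⟶ K)
    (hq : Function.Surjective q) (h : ∀ X : D, q X = 0 ↔ ∀ Y : D, X * Y = 0) :
    IsCornerEmbedding q := by
  let F := cornerModule (zeroModule D)
  have hF : F.Cofull := cofull_cornerModule _ fun ξ => by
    rw [Subsingleton.elim ξ 0]; exact zero_mem _
  have hmem : ∀ X : D, leftMul (zeroModule D) X ∈ F.compact := by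
    intro X
    refine AddSubgroup.closure_le (K := (AddSubgroup.closure F.elementary).comap
      (leftMul (zeroModule D))) |>.2 ?_ (D.quadratik X)
    rintro _ ⟨b, c, rfl⟩
    refine AddSubgroup.subset_closure ⟨((0 : zeroModule D), ((b : D), (0 : zeroModule D))),
      AddMonoidHom.mk' (fun x => c * x.2.1) (fun x y => mul_add c x.2.1 y.2.1), ?_, ?_⟩
    · rw [mem_functionals_cornerModule]
      exact ⟨0, zero_mem _, c, fun ξ x η => by simp⟩
    · exact AddMonoidHom.ext fun x => Prod.ext (Subsingleton.elim _ _)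
        (Prod.ext (mul_assoc b c x.2.1) (Subsingleton.elim _ _))
  let l : D ⟶ F.compactRing hF :=
    ⟨{ toFun := fun X => ⟨leftMul _ X, hmem X⟩
       map_zero' := Subtype.ext (map_zero _)
       map_add' := fun X Y => Subtype.ext (map_add _ X Y)
       map_mul' := fun X Y => Subtype.ext (AddMonoidHom.ext fun x =>
         Prod.ext rfl (Prod.ext (mul_assoc X Y x.2.1) rfl)) },
     fun g X => Subtype.ext (AddMonoidHom.ext fun x => by
       refine Prod.ext (Subsingleton.elim _ _) (Prod.ext ?_ (Subsingleton.elim _ _))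
       change D.act g X * x.2.1 = D.act g (X * D.act g⁻¹ x.2.1)
       rw [map_mul, ← GRing.act_mul, mul_inv_cancel, GRing.act_one])⟩
  have hl : Function.Surjective l := by
    have gen : ∀ (T : AddMonoid.End F), T ∈ AddSubgroup.closure F.elementary →
        ∃ X : D, leftMul _ X = T := by
      intro T hT
      refine AddSubgroup.closure_le (K := (leftMul (zeroModule D)).range) |>.2 ?_ hT
      rintro _ ⟨η, χ, hχ, rfl⟩
      obtain ⟨φ, -, c, hc⟩ := (mem_functionals_cornerModule _ _).1 hχ
      refine ⟨η.2.1 * c, AddMonoidHom.ext fun x => Prod.ext (Subsingleton.elim _ _)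
        (Prod.ext ?_ (Subsingleton.elim _ _))⟩
      change η.2.1 * c * x.2.1 = η.2.1 * χ x
      have := hc x.1 x.2.1 x.2.2
      rw [Subsingleton.elim x.1 0, map_zero, zero_add] at this
      rw [mul_assoc, ← this, ← Subsingleton.elim x.1 0]
    rintro ⟨T, hT⟩
    obtain ⟨X, hX⟩ := gen T hT
    exact ⟨X, Subtype.ext hX⟩
  have hker : ∀ X : D, q X = 0 ↔ l X = 0 := by
    intro X
    rw [h]
    constructor
    · intro hX
      exact Subtype.ext (AddMonoidHom.ext fun x =>
        Prod.ext rfl (Prod.ext (hX x.2.1) rfl))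
    · intro hX Y
      have := congrArg (fun T : F.compactRing hF =>
        ((T.1 : AddMonoid.End F) ((0 : zeroModule D), ((Y : D), (0 : zeroModule D)))).2.1) hX
      exact this
  obtain ⟨κ, hκ⟩ := GRing.exists_iso q hq l hl hker
  refine ⟨zeroModule D, PEmpty, zeroAction D, hF, κ, fun a ξ b η => ?_⟩
  have : κ.hom (q a) = l a := by rw [← hκ]; rfl
  rw [this]
  rfl

section MatrixCorner

variable {G : Type v} [Group G] {M : GRing.{u, v} G} {δ : G →* (M →ₙ+* M)}
  {θ : G →* (Matrix (Fin 2) (Fin 2) M →ₙ+* Matrix (Fin 2) (Fin 2) M)}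

theorem act_lower (h11 : ∀ g m, θ g (Matrix.single 0 0 m) = Matrix.single 0 0 (M.act g m))
    (h22 : ∀ g m, θ g (Matrix.single 1 1 m) = Matrix.single 1 1 (δ g m)) (g : G) (x : M) :
    θ g (Matrix.single 1 0 x) = Matrix.single 1 0 (θ g (Matrix.single 1 0 x) 1 0) := by
  have row : ∀ (x : M) (j : Fin 2), θ g (Matrix.single 1 0 x) 0 j = 0 := by
    intro x j
    have := M.quadratik x
    induction this using AddSubgroup.closure_induction with
    | zero => simp
    | add x y _ _ h1 h2 => rw [Matrix.single_add, map_add, Matrix.add_apply, h1, h2, add_zero]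
    | neg x _ h =>
      have e : Matrix.single (1 : Fin 2) (0 : Fin 2) (-x) = -Matrix.single 1 0 x :=
        map_neg (Matrix.singleAddMonoidHom 1 0) x
      rw [e, map_neg, Matrix.neg_apply, h, neg_zero]
    | mem x hx =>
      obtain ⟨b, c, rfl⟩ := hx
      have e : Matrix.single (1 : Fin 2) (0 : Fin 2) (b * c) =
        Matrix.single 1 1 b * Matrix.single 1 0 c := by simp
      rw [e, map_mul, h22]
      simp [Matrix.mul_apply]
  have col : ∀ (x : M) (i : Fin 2), θ g (Matrix.single 1 0 x) i 1 = 0 := by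
    intro x i
    have := M.quadratik x
    induction this using AddSubgroup.closure_induction with
    | zero => simp
    | add x y _ _ h1 h2 => rw [Matrix.single_add, map_add, Matrix.add_apply, h1, h2, add_zero]
    | neg x _ h =>
      have e : Matrix.single (1 : Fin 2) (0 : Fin 2) (-x) = -Matrix.single 1 0 x :=
        map_neg (Matrix.singleAddMonoidHom 1 0) x
      rw [e, map_neg, Matrix.neg_apply, h, neg_zero]
    | mem x hx =>
      obtain ⟨b, c, rfl⟩ := hx
      have e : Matrix.single (1 : Fin 2) (0 : Fin 2) (b * c) =
        Matrix.single 1 0 b * Matrix.single 0 0 c := by simp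
      rw [e, map_mul, h11]
      simp [Matrix.mul_apply]
  ext i j
  fin_cases i <;> fin_cases j <;> simp [row, col]

/-- The ring `M` as a right module over itself, with the `G`-action of the lower left corner. -/
noncomputable abbrev lowerModule
    (h11 : ∀ g m, θ g (Matrix.single 0 0 m) = Matrix.single 0 0 (M.act g m))
    (h22 : ∀ g m, θ g (Matrix.single 1 1 m) = Matrix.single 1 1 (δ g m)) :
    FunctionalModule M where
  carrier := M
  smul := AddMonoidHom.mul
  smul_mul a b c := by simp [mul_assoc]
  act g := AddMonoidHom.mk' (fun x => θ g (Matrix.single 1 0 x) 1 0) fun x y => by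
    rw [Matrix.single_add, map_add, Matrix.add_apply]
  act_one x := by simp
  act_mul g h x := by
    change θ (g * h) _ 1 0 = θ g (Matrix.single 1 0 (θ h (Matrix.single 1 0 x) 1 0)) 1 0
    rw [← act_lower h11 h22, map_mul]
    rfl
  act_smul g x a := by
    change θ g (Matrix.single 1 0 (x * a)) 1 0 = θ g (Matrix.single 1 0 x) 1 0 * M.act g a
    have e : Matrix.single (1 : Fin 2) (0 : Fin 2) (x * a) =
      Matrix.single 1 0 x * Matrix.single 0 0 a := by simp
    rw [e, map_mul, h11]
    simp [Matrix.mul_apply]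
  functionals := AddMonoidHom.range (AddMonoidHom.mul (R := M))
  map_smul := by
    rintro _ ⟨b, rfl⟩ a c
    simp [mul_assoc]
  mul_mem := by
    rintro a _ ⟨b, rfl⟩
    exact ⟨a * b, by ext x; simp [mul_assoc]⟩
  conj_mem := by
    rintro g _ ⟨b, rfl⟩
    refine ⟨θ g (Matrix.single 0 1 b) 0 1, AddMonoidHom.ext fun x => ?_⟩
    change θ g (Matrix.single 0 1 b) 0 1 * x =
      M.act g (b * θ g⁻¹ (Matrix.single 1 0 x) 1 0)
    have e : Matrix.single (0 : Fin 2) (0 : Fin 2)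
        (M.act g (b * θ g⁻¹ (Matrix.single 1 0 x) 1 0)) =
        θ g (Matrix.single 0 1 b) * Matrix.single 1 0 x := by
      have e' : ∀ y : M, Matrix.single (0 : Fin 2) (0 : Fin 2) (b * y) =
        Matrix.single 0 1 b * Matrix.single 1 0 y := fun y => by simp
      rw [← h11, e', map_mul, ← act_lower h11 h22]
      congr 1
      have := congrArg (fun T => T (Matrix.single (1 : Fin 2) (0 : Fin 2) x))
        (θ.map_mul g g⁻¹)
      rw [mul_inv_cancel, map_one] at this
      exact this.symm
    have := congrFun (congrFun e 0) 0
    simpa [Matrix.mul_apply] using this.symm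

/-- The action of `2 × 2` matrices over `M` on `M ⊕ (M ⊕ 0)`, where the distinguished coordinate
is the coordinate with index `0` of a column. -/
noncomputable def matMul
    (h11 : ∀ g m, θ g (Matrix.single 0 0 m) = Matrix.single 0 0 (M.act g m))
    (h22 : ∀ g m, θ g (Matrix.single 1 1 m) = Matrix.single 1 1 (δ g m)) :
    Matrix (Fin 2) (Fin 2) M →+ AddMonoid.End (cornerModule (lowerModule h11 h22)) :=
  AddMonoidHom.mk' (fun X => AddMonoidHom.mk'
      (fun x => (((X 1 0 * x.2.1 + X 1 1 * x.1 : M),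
        ((X 0 0 * x.2.1 + X 0 1 * x.1 : M), (0 : zeroModule M))) :
          cornerModule (lowerModule h11 h22)))
      (fun x y => Prod.ext (by
          change X 1 0 * (x.2.1 + y.2.1) + X 1 1 * (x.1 + y.1) =
            (X 1 0 * x.2.1 + X 1 1 * x.1) + (X 1 0 * y.2.1 + X 1 1 * y.1)
          rw [mul_add, mul_add]; abel)
        (Prod.ext (by
          change X 0 0 * (x.2.1 + y.2.1) + X 0 1 * (x.1 + y.1) =
            (X 0 0 * x.2.1 + X 0 1 * x.1) + (X 0 0 * y.2.1 + X 0 1 * y.1)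
          rw [mul_add, mul_add]; abel) (add_zero 0).symm)))
    (fun X Y => AddMonoidHom.ext fun x => Prod.ext (by
          change (X 1 0 + Y 1 0) * x.2.1 + (X 1 1 + Y 1 1) * x.1 =
            (X 1 0 * x.2.1 + X 1 1 * x.1) + (Y 1 0 * x.2.1 + Y 1 1 * x.1)
          rw [add_mul, add_mul]; abel)
        (Prod.ext (by
          change (X 0 0 + Y 0 0) * x.2.1 + (X 0 1 + Y 0 1) * x.1 =
            (X 0 0 * x.2.1 + X 0 1 * x.1) + (Y 0 0 * x.2.1 + Y 0 1 * x.1)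
          rw [add_mul, add_mul]; abel) (add_zero 0).symm))

/-- The corner embedding `e₁₁ : M → M₂(M)` into the upper left corner. -/
def cornerOne (h11 : ∀ g m, θ g (Matrix.single 0 0 m) = Matrix.single 0 0 (M.act g m)) :
    M ⟶ M.mat θ where
  toRingHom :=
    { toFun := fun m => Matrix.single 0 0 m
      map_zero' := Matrix.single_zero 0 0
      map_add' := fun a b => Matrix.single_add 0 0 a b
      map_mul' := fun a b => (Matrix.single_mul_single_same (m := Fin 2) a 0 0 0 b).symm }
  equivariant g m := (h11 g m).symm

/-- The corner embedding `e₂₂ : M → M₂(M)` into the lower right corner. -/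
def cornerTwo (h22 : ∀ g m, θ g (Matrix.single 1 1 m) = Matrix.single 1 1 (δ g m)) :
    M.withAction δ ⟶ M.mat θ where
  toRingHom :=
    { toFun := fun m => Matrix.single 1 1 m
      map_zero' := Matrix.single_zero 1 1
      map_add' := fun a b => Matrix.single_add 1 1 a b
      map_mul' := fun a b => (Matrix.single_mul_single_same (m := Fin 2) a 1 1 1 b).symm }
  equivariant g m := (h22 g m).symm

theorem isIso_cornerOne
    (h11 : ∀ g m, θ g (Matrix.single 0 0 m) = Matrix.single 0 0 (M.act g m))
    (h22 : ∀ g m, θ g (Matrix.single 1 1 m) = Matrix.single 1 1 (δ g m)) :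
    IsIso ((GK.ι G).map (cornerOne h11)) := by
  let E : FunctionalModule M := lowerModule h11 h22
  let F := cornerModule E
  have hF : F.Cofull := cofull_cornerModule E fun ξ => by
    refine AddSubgroup.closure_mono ?_ (M.quadratik ξ)
    rintro _ ⟨b, c, rfl⟩
    exact ⟨b, c, rfl⟩
  have hfun : ∀ c₀ c₁ : M, ∃ χ ∈ F.functionals, ∀ x : F, χ x = c₁ * x.1 + c₀ * x.2.1 := by
    intro c₀ c₁
    refine ⟨AddMonoidHom.mk' (fun x => c₁ * x.1 + c₀ * x.2.1) (fun x y => ?_), ?_, fun x => rfl⟩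
    · change c₁ * (x.1 + y.1) + c₀ * (x.2.1 + y.2.1) =
        (c₁ * x.1 + c₀ * x.2.1) + (c₁ * y.1 + c₀ * y.2.1)
      rw [mul_add, mul_add]; abel
    · rw [mem_functionals_cornerModule]
      exact ⟨_, ⟨c₁, rfl⟩, c₀, fun _ _ _ => rfl⟩
  have hmem : ∀ X, matMul h11 h22 X ∈ F.compact := by
    have hs : ∀ (i j : Fin 2) (x : M), matMul h11 h22 (Matrix.single i j x) ∈
        AddSubgroup.closure F.elementary := by
      intro i j x
      refine AddSubgroup.closure_le (K := (AddSubgroup.closure F.elementary).comap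
        ((matMul h11 h22).comp (Matrix.singleAddMonoidHom i j))) |>.2 ?_ (M.quadratik x)
      rintro _ ⟨b, c, rfl⟩
      obtain ⟨χ, hχ, hχ'⟩ := hfun (if j = 0 then c else 0) (if j = 0 then 0 else c)
      refine AddSubgroup.subset_closure ⟨((if i = 0 then 0 else b : M),
        ((if i = 0 then b else 0 : M), (0 : zeroModule M))), χ, hχ, ?_⟩
      refine AddMonoidHom.ext fun x => Prod.ext ?_ (Prod.ext ?_ (Subsingleton.elim _ _))
      · change Matrix.single i j (b * c) 1 0 * x.2.1 + Matrix.single i j (b * c) 1 1 * x.1 =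
          (if i = 0 then 0 else b : M) * χ x
        rw [hχ']
        fin_cases i <;> fin_cases j <;> simp [mul_assoc]
      · change Matrix.single i j (b * c) 0 0 * x.2.1 + Matrix.single i j (b * c) 0 1 * x.1 =
          (if i = 0 then b else 0 : M) * χ x
        rw [hχ']
        fin_cases i <;> fin_cases j <;> simp [mul_assoc]
    intro X
    rw [Matrix.matrix_eq_sum_single X, map_sum]
    refine sum_mem fun i _ => ?_
    rw [map_sum]
    exact sum_mem fun j _ => hs i j _
  let col : F → Matrix (Fin 2) (Fin 2) M := fun x =>
    Matrix.single 0 0 x.2.1 + Matrix.single 1 0 x.1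
  have col_inj : ∀ x y : F, col x = col y → x = y := by
    intro x y h
    refine Prod.ext ?_ (Prod.ext ?_ (Subsingleton.elim _ _))
    · simpa [col] using congrFun (congrFun h 1) 0
    · simpa [col] using congrFun (congrFun h 0) 0
  have col_mul : ∀ X (x : F), X * col x = col (matMul h11 h22 X x) := by
    intro X x
    have e0 : (matMul h11 h22 X x).2.1 = X 0 0 * x.2.1 + X 0 1 * x.1 := rfl
    have e1 : (matMul h11 h22 X x).1 = X 1 0 * x.2.1 + X 1 1 * x.1 := rfl
    simp only [col, e0, e1]
    ext i j
    fin_cases i <;> fin_cases j <;> simp [mul_add, Matrix.mul_apply]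
  have col_act : ∀ g (x : F), θ g (col x) = col (F.act g x) := by
    intro g x
    simp only [col]
    rw [map_add, h11, act_lower h11 h22]
    rfl
  let q : M.mat θ ⟶ F.compactRing hF :=
    ⟨{ toFun := fun X => ⟨matMul h11 h22 X, hmem X⟩
       map_zero' := Subtype.ext (map_zero _)
       map_add' := fun X Y => Subtype.ext (map_add (matMul h11 h22) X Y)
       map_mul' := fun X Y => Subtype.ext (AddMonoidHom.ext fun x => col_inj _ _ (by
         change col (matMul h11 h22 (X * Y : Matrix (Fin 2) (Fin 2) M) x) =
           col (matMul h11 h22 X (matMul h11 h22 Y x))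
         rw [← col_mul, ← col_mul, ← col_mul, mul_assoc])) },
     fun g X => Subtype.ext (AddMonoidHom.ext fun x => col_inj _ _ (by
       change col (matMul h11 h22 (θ g X) x) = col (F.act g (matMul h11 h22 X (F.act g⁻¹ x)))
       rw [← col_mul, ← col_act, ← col_mul, map_mul, col_act, F.act_act_inv]))⟩
  have hq : Function.Surjective q := by
    have gen : ∀ (T : AddMonoid.End F), T ∈ AddSubgroup.closure F.elementary →
        ∃ X, matMul h11 h22 X = T := by
      intro T hT
      refine AddSubgroup.closure_le (K := (matMul h11 h22).range) |>.2 ?_ hT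
      rintro _ ⟨η, χ, hχ, rfl⟩
      obtain ⟨_, ⟨c₁, rfl⟩, c₀, hc⟩ := (mem_functionals_cornerModule _ _).1 hχ
      have hχ' : ∀ x : F, χ x = c₁ * x.1 + c₀ * x.2.1 := fun x => hc x.1 x.2.1 x.2.2
      refine ⟨!![η.2.1 * c₀, η.2.1 * c₁; η.1 * c₀, η.1 * c₁], AddMonoidHom.ext fun x =>
        Prod.ext ?_ (Prod.ext ?_ (Subsingleton.elim _ _))⟩
      · change η.1 * c₀ * x.2.1 + η.1 * c₁ * x.1 = η.1 * χ x
        rw [hχ', mul_add, mul_assoc, mul_assoc, add_comm]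
      · change η.2.1 * c₀ * x.2.1 + η.2.1 * c₁ * x.1 = η.2.1 * χ x
        rw [hχ', mul_add, mul_assoc, mul_assoc, add_comm]
    rintro ⟨T, hT⟩
    obtain ⟨X, hX⟩ := gen T hT
    exact ⟨X, Subtype.ext hX⟩
  have hker : ∀ X : M.mat θ, q X = 0 ↔ ∀ Y : M.mat θ, X * Y = 0 := by
    intro X
    constructor
    · intro hX Y
      have h0 : ∀ x : F, matMul h11 h22 X x = 0 := fun x =>
        congrArg (fun T : F.compactRing hF => (T.1 : AddMonoid.End F) x) hX
      have hij : ∀ (i j : Fin 2) (y : M), X i j * y = 0 := by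
        intro i j y
        have a1 : X 1 0 * y + X 1 1 * 0 = 0 :=
          congrArg (fun z : F => z.1) (h0 ((0 : M), ((y : M), (0 : zeroModule M))))
        have a2 : X 0 0 * y + X 0 1 * 0 = 0 :=
          congrArg (fun z : F => z.2.1) (h0 ((0 : M), ((y : M), (0 : zeroModule M))))
        have a3 : X 1 0 * 0 + X 1 1 * y = 0 :=
          congrArg (fun z : F => z.1) (h0 ((y : M), ((0 : M), (0 : zeroModule M))))
        have a4 : X 0 0 * 0 + X 0 1 * y = 0 :=
          congrArg (fun z : F => z.2.1) (h0 ((y : M), ((0 : M), (0 : zeroModule M))))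
        rw [mul_zero, add_zero] at a1 a2
        rw [mul_zero, zero_add] at a3 a4
        fin_cases i <;> fin_cases j <;> assumption
      refine Matrix.ext fun i j => ?_
      exact (Matrix.mul_apply ..).trans (Finset.sum_eq_zero fun k _ => hij i k _)
    · intro hX
      refine Subtype.ext (AddMonoidHom.ext fun x => col_inj _ _ ?_)
      change col (matMul h11 h22 X x) = col 0
      rw [← col_mul]
      refine (hX (col x)).trans ?_
      have e0 : (0 : F).2.1 = 0 := rfl
      have e1 : (0 : F).1 = 0 := rfl
      simp only [col, e0, e1, Matrix.single_zero, add_zero]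
  have hc : IsCornerEmbedding (cornerOne h11 ≫ q) := by
    refine ⟨E, PEmpty, zeroAction M, hF, Iso.refl _, fun a ξ b η => ?_⟩
    refine Prod.ext ?_ (Prod.ext ?_ (Subsingleton.elim _ _))
    · change Matrix.single (0 : Fin 2) (0 : Fin 2) a 1 0 * b +
        Matrix.single (0 : Fin 2) (0 : Fin 2) a 1 1 * (ξ : M) = 0
      simp
    · change Matrix.single (0 : Fin 2) (0 : Fin 2) a 0 0 * b +
        Matrix.single (0 : Fin 2) (0 : Fin 2) a 0 1 * (ξ : M) = a * b
      simp
  have i1 := GK.isIso_corner hc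
  have i2 := GK.isIso_corner (isCornerEmbedding_of_surjective q hq hker)
  exact IsIso.of_isIso_fac_right ((GK.ι G).map_comp (cornerOne h11) q).symm

end MatrixCorner

/-! ### Double split exact sequences -/

/-- A double split exact sequence: a split exact sequence `B → (M, γ) → A` of `G`-rings with split
`s` (written `s₋`), a second `G`-action `δ` on `M`, an equivariant ring homomorphism `t : A → (M, δ)`
(written `s₊`) which is a non-equivariant split of `f`, and a `G`-action `θ` on `M₂(M)` for which
the corner embeddings `e₁₁ : (M, γ) → (M₂(M), θ)`, `e₂₂ : (M, δ) → (M₂(M), θ)` and the map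
`f ⊗ 1 : (M₂(M), θ) → (M₂(A), α ⊗ 1)` are equivariant. -/
structure DoubleSplit {G : Type v} [Group G] (B M A : GRing.{u, v} G) extends SplitExact B M A where
  δ : G →* (M →ₙ+* M)
  t : A ⟶ M.withAction δ
  split_t : ∀ a : A, f (t a : M) = a
  θ : G →* (Matrix (Fin 2) (Fin 2) M →ₙ+* Matrix (Fin 2) (Fin 2) M)
  e₁₁_equivariant : ∀ (g : G) (m : M),
    θ g (Matrix.single 0 0 m) = Matrix.single 0 0 (M.act g m)
  e₂₂_equivariant : ∀ (g : G) (m : M),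
    θ g (Matrix.single 1 1 m) = Matrix.single 1 1 (δ g m)
  f_equivariant : ∀ (g : G) (X : Matrix (Fin 2) (Fin 2) M),
    (θ g X).map f = (X.map f).map (A.act g)

namespace DoubleSplit

variable {G : Type v} [Group G] {B M A : GRing.{u, v} G}

/-- The corner embedding `e₁₁ : (M, γ) → (M₂(M), θ)`. -/
def e₁₁ (S : DoubleSplit B M A) : M ⟶ M.mat S.θ := cornerOne S.e₁₁_equivariant

/-- The corner embedding `e₂₂ : (M, δ) → (M₂(M), θ)`. -/
def e₂₂ (S : DoubleSplit B M A) : M.withAction S.δ ⟶ M.mat S.θ := cornerTwo S.e₂₂_equivariant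

instance (S : DoubleSplit B M A) : IsIso ((GK.ι G).map S.e₁₁) :=
  isIso_cornerOne S.e₁₁_equivariant S.e₂₂_equivariant

/-- The morphism `μ = e₂₂ e₁₁⁻¹ : (M, δ) → (M, γ)` in `GK^G`. -/
noncomputable def μ (S : DoubleSplit B M A) :
    (GK.ι G).obj (M.withAction S.δ) ⟶ (GK.ι G).obj M :=
  (GK.ι G).map S.e₂₂ ≫ inv ((GK.ι G).map S.e₁₁)

/-- The morphism `t μ Δ_s : A → B` in `GK^G` associated to the double split exact sequence. -/
noncomputable def toGK (S : DoubleSplit B M A) : (GK.ι G).obj A ⟶ (GK.ι G).obj B :=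
  (GK.ι G).map S.t ≫ S.μ ≫ GK.Δ S.toSplitExact

end DoubleSplit

namespace GK

variable {G : Type v} [Group G]

/-- `x : A ⟶ Z` in `GK^G` is the morphism `t μ Δ_s e⁻¹` associated to an extended double split exact
sequence: a double split exact sequence `S` together with a corner embedding `e : Z → B`. -/
def IsExtendedDoubleSplit {A Z : GK.{u, v} G} (x : A ⟶ Z) : Prop :=
  ∃ (B M : GRing.{u, v} G) (S : DoubleSplit B M A.ring) (e : Z.ring ⟶ B)
    (he : IsCornerEmbedding e), x = S.toGK ≫ cornerInv e he

/-- `IsWord n x`: the morphism `x` is a product of `n ≥ 1` (morphisms associated to) extended double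
split exact sequences. -/
inductive IsWord : ℕ → ∀ {A B : GK.{u, v} G}, (A ⟶ B) → Prop
  | single {A B : GK.{u, v} G} {x : A ⟶ B} : IsExtendedDoubleSplit x → IsWord 1 x
  | cons {A B C : GK.{u, v} G} {n : ℕ} {x : A ⟶ B} {y : B ⟶ C} :
      IsExtendedDoubleSplit x → IsWord n y → IsWord (n + 1) (x ≫ y)

/-- `IsTerm N z`: the morphism `z` is a term of `N` extended double split exact sequences, that is,
`z = ± w₁ ± w₂ ± ⋯ ± w_k` with `k ≥ 1` products `w_i` of extended double split exact sequences,
in which `N` factors occur altogether (repetitions are counted). -/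
inductive IsTerm {A B : GK.{u, v} G} : ℕ → (A ⟶ B) → Prop
  | pos {n : ℕ} {w : A ⟶ B} : IsWord n w → IsTerm n w
  | neg {n : ℕ} {w : A ⟶ B} : IsWord n w → IsTerm n (-w)
  | add {m n : ℕ} {z w : A ⟶ B} : IsTerm m z → IsWord n w → IsTerm (m + n) (z + w)
  | sub {m n : ℕ} {z w : A ⟶ B} : IsTerm m z → IsWord n w → IsTerm (m + n) (z - w)

/-- The group `L₀ GK^G(A, B)` of level-`0` morphisms: the subgroup generated by the ring
homomorphisms from `A` to `B`. -/
def levelZero (A B : GK.{u, v} G) : AddSubgroup (A ⟶ B) :=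
  AddSubgroup.closure {x | ∃ f : A.ring ⟶ B.ring, x = (ι G).map f}

/-- `P` is right-invertible: there is `Q` with `P Q = 1`. -/
def RightInvertible {A B : GK.{u, v} G} (P : A ⟶ B) : Prop :=
  ∃ Q : B ⟶ A, P ≫ Q = 𝟙 A

end GK

/-! ### The defining relations of `GK^G` as equations of morphisms -/

namespace GK

variable {G : Type v} [Group G]

/-! Right-invertible homomorphisms can absorb every formal inverse and every formal split, so every
morphism of `GK^G` can be moved to level 0. The property that can be proved by induction over formal
expressions is `Reducible`: for every homomorphism `φ : B → C` there is a right-invertible `P : C →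
D` such that `x φ P` is level 0. The freedom in `φ` makes it stable under sums (move `x` with `φ`,
then `y` with `φ P`) and under products (move `y φ` to level 0, then treat `x` followed by each of
the homomorphisms that occur). Only the generators remain.

For a corner embedding `e : A → K_A(F)` and `φ : A → C`, base change gives a homomorphism `T ↦ T ⊗ 1
⊕ 0` from `K_A(F)` to `K_C(F ⊗_A C ⊕ C)`. On the corner `A` it is homotopic, by a rotation
exchanging the summand `A ⊗_A C` of `F ⊗_A C` with `C`, to `φ` followed by the corner embedding `c`
of `C` (`map_pushHom_eq`). Hence `e⁻¹ φ c` is the base change homomorphism itself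
(`reducible_cornerInv`).

For a split exact sequence `B → M → A` and `φ : B → C`, the ring `M` acts on its ideal `B`, hence on
`B ⊗_B C ⊕ C`. This gives a homomorphism `m` from `M` to the semidirect product of `K_C(B ⊗_B C ⊕
C)` with `A`. Let `j'` be the inclusion of the compact operators there. By the same rotation `φ c j'
= j m`, so `Δ_s φ c j' = Δ_s j m = m - f s m` is level 0. Here `c j'` is right-invertible, because
`c` is invertible and `j'` has the right inverse `Δ` (`reducible_Δ`). This settles (ii), see
`exists_levelZero`.

For (i), passing to matrix rings turns a level-0 morphism into a difference `h - k` of two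
homomorphisms (`exists_eq_sub_of_levelZero`). Such a difference is the morphism of one extended
double split exact sequence, built on a direct sum (`isExtendedDoubleSplit_sub`). So is the
identity, being `1 - 0`; the word `h - k` can therefore be padded with identities to any length from
1 on, in particular to `N - 1`. -/

theorem j_comp_Δ {B M A : GRing.{u, v} G} (S : SplitExact B M A) :
    (ι G).map S.j ≫ Δ S = 𝟙 ((ι G).obj B) :=
  Quot.sound (.j_delta S)

theorem Δ_comp_j {B M A : GRing.{u, v} G} (S : SplitExact B M A) :
    Δ S ≫ (ι G).map S.j = 𝟙 ((ι G).obj M) - (ι G).map S.f ≫ (ι G).map S.s := by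
  rw [eq_sub_iff_add_eq]
  exact (Quot.sound (.delta_j S)).symm

theorem corner_comp_inv {A D : GRing.{u, v} G} (e : A ⟶ D) (he : IsCornerEmbedding e) :
    (ι G).map e ≫ cornerInv e he = 𝟙 ((ι G).obj A) :=
  Quot.sound (.corner_inv e he)

theorem inv_comp_corner {A D : GRing.{u, v} G} (e : A ⟶ D) (he : IsCornerEmbedding e) :
    cornerInv e he ≫ (ι G).map e = 𝟙 ((ι G).obj D) :=
  Quot.sound (.inv_corner e he)

theorem map_eq_of_homotopic {A B : GRing.{u, v} G} {f₀ f₁ : A ⟶ B} (h : Homotopic f₀ f₁) :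
    (ι G).map f₀ = (ι G).map f₁ :=
  Quot.sound (.homotopy f₀ f₁ h)

theorem biproduct (A B : GRing.{u, v} G) :
    𝟙 ((ι G).obj (A.prod B)) =
      (ι G).map (A.fst B) ≫ (ι G).map (A.inl B) + (ι G).map (A.snd B) ≫ (ι G).map (A.inr B) :=
  Quot.sound (.biproduct A B)

end GK

/-! ### Direct sums and matrix rings with the entrywise action -/

namespace GRing

variable {G : Type v} [Group G]

/-- The zero homomorphism. -/
def zeroHom (A B : GRing.{u, v} G) : A ⟶ B :=
  ⟨0, fun g _ => (map_zero (B.act g)).symm⟩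

/-- The homomorphism into a direct sum with given coordinates. -/
def lift {A B C : GRing.{u, v} G} (f : A ⟶ B) (k : A ⟶ C) : A ⟶ B.prod C :=
  ⟨NonUnitalRingHom.prod f.toRingHom k.toRingHom, fun g a =>
    Prod.ext (f.equivariant g a) (k.equivariant g a)⟩

/-- The entrywise action on `2 × 2` matrices. -/
def entrywise (A : GRing.{u, v} G) :
    G →* (Matrix (Fin 2) (Fin 2) A →ₙ+* Matrix (Fin 2) (Fin 2) A) where
  toFun g :=
    { toFun := fun X => X.map (A.act g)
      map_zero' := Matrix.map_zero _ (map_zero _)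
      map_add' := Matrix.map_add _ (map_add _)
      map_mul' := fun X Y => by ext i j; simp [Matrix.mul_apply] }
  map_one' := NonUnitalRingHom.ext fun X => Matrix.ext fun i j => A.act_one (X i j)
  map_mul' g h := NonUnitalRingHom.ext fun X => Matrix.ext fun i j => A.act_mul g h (X i j)

theorem entrywise_apply (A : GRing.{u, v} G) (g : G) (X : Matrix (Fin 2) (Fin 2) A) :
    A.entrywise g X = X.map (A.act g) := rfl

theorem entrywise_single (A : GRing.{u, v} G) (i j : Fin 2) (g : G) (a : A) :
    A.entrywise g (Matrix.single i j a) = Matrix.single i j (A.act g a) := by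
  rw [entrywise_apply, Matrix.map_single]

/-- The `2 × 2` matrices with the entrywise action. -/
abbrev mat₂ (A : GRing.{u, v} G) : GRing.{u, v} G := A.mat A.entrywise

/-- The embedding of `A` into the upper left corner of `mat₂ A`. -/
def upperLeft (A : GRing.{u, v} G) : A ⟶ A.mat₂ := cornerOne (A.entrywise_single 0 0)

/-- The embedding of `A` into the lower right corner of `mat₂ A`. -/
def lowerRight (A : GRing.{u, v} G) : A ⟶ A.mat₂ :=
  cornerTwo (δ := A.act) (A.entrywise_single 1 1)

instance (A : GRing.{u, v} G) : IsIso ((GK.ι G).map A.upperLeft) :=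
  isIso_cornerOne (δ := A.act) (A.entrywise_single 0 0) (A.entrywise_single 1 1)

end GRing

/-! ### Rotation homotopies -/

/-- The path `t ↦ cos (π t / 2)`. -/
noncomputable def cosPath : C(unitInterval, ℂ) :=
  ⟨fun t => (Real.cos (Real.pi / 2 * t) : ℂ), by fun_prop⟩

/-- The path `t ↦ sin (π t / 2)`. -/
noncomputable def sinPath : C(unitInterval, ℂ) :=
  ⟨fun t => (Real.sin (Real.pi / 2 * t) : ℂ), by fun_prop⟩

theorem cosPath_sq_add : cosPath * cosPath + sinPath * sinPath = 1 := by
  ext t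
  change ((Real.cos (Real.pi / 2 * t) : ℂ)) * (Real.cos (Real.pi / 2 * t) : ℂ) +
    (Real.sin (Real.pi / 2 * t) : ℂ) * (Real.sin (Real.pi / 2 * t) : ℂ) = 1
  rw [← Complex.ofReal_mul, ← Complex.ofReal_mul, ← Complex.ofReal_add]
  rw [← sq, ← sq, Real.cos_sq_add_sin_sq, Complex.ofReal_one]

/-- The unit vector `(cos (π t / 2), sin (π t / 2))`. -/
noncomputable def rotVec (i : Fin 2) : C(unitInterval, ℂ) := if i = 0 then cosPath else sinPath

theorem sum_rotVec : ∑ i, rotVec i * rotVec i = 1 := by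
  simpa [Fin.sum_univ_two, rotVec] using cosPath_sq_add

theorem rotVec_zero (i : Fin 2) : rotVec i 0 = if i = 0 then 1 else 0 := by
  fin_cases i <;> simp [rotVec, cosPath, sinPath]

theorem rotVec_one (i : Fin 2) : rotVec i 1 = if i = 1 then 1 else 0 := by
  fin_cases i <;> simp [rotVec, cosPath, sinPath]

section Rotation

variable {G : Type v} [Group G]

/-- The path of homomorphisms obtained from a system of matrix units and a path of rank one
projections. -/
noncomputable def rotationHom {R S : Type*} [NonUnitalRing R] [NonUnitalRing S]
    (u : Fin 2 → Fin 2 → S →+ R)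
    (hu : ∀ i j k l a b, u i j a * u k l b = if j = k then u i l (a * b) else 0) :
    S →ₙ+* (R ⊗[ℤ] C(unitInterval, ℂ)) where
  toFun a := ∑ i, ∑ j, u i j a ⊗ₜ[ℤ] (rotVec i * rotVec j)
  map_zero' := by simp
  map_add' a b := by
    simp only [map_add, TensorProduct.add_tmul, Finset.sum_add_distrib]
  map_mul' a b := by
    have h : ∀ i j k l : Fin 2,
        u i j a ⊗ₜ[ℤ] (rotVec i * rotVec j) * u k l b ⊗ₜ[ℤ] (rotVec k * rotVec l) =
        if j = k then u i l (a * b) ⊗ₜ[ℤ]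
          ((rotVec i * rotVec l) * (rotVec j * rotVec j)) else 0 := by
      intro i j k l
      rw [Algebra.TensorProduct.tmul_mul_tmul, hu]
      split_ifs with hjk
      · subst hjk
        congr 1
        ring
      · rw [TensorProduct.zero_tmul]
    -- Inserting `∑ j, r_j² = 1` supplies the middle index over which the product of the two double
    -- sums runs.
    have h' : ∀ i l : Fin 2, u i l (a * b) ⊗ₜ[ℤ] (rotVec i * rotVec l) =
        ∑ j, u i l (a * b) ⊗ₜ[ℤ] ((rotVec i * rotVec l) * (rotVec j * rotVec j)) := fun i l => by
      rw [← TensorProduct.tmul_sum, ← Finset.mul_sum, sum_rotVec, mul_one]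
    simp only [h', Fin.sum_univ_two, add_mul, mul_add, h]
    simp
    abel

/-- The path is `a ↦ ∑ u i j a ⊗ r_i r_j` with the unit vector `r = (cos, sin)`. It is
multiplicative because the scalar matrix `r rᵀ` is idempotent and its entries commute with
everything. No unit and no conjugation by a rotation is needed, so the target may be any ring
containing such blocks. -/
theorem homotopic_of_matrix_units {A B : GRing.{u, v} G} (u : Fin 2 → Fin 2 → A →+ B)
    (hu : ∀ i j k l a b, u i j a * u k l b = if j = k then u i l (a * b) else 0)
    (hG : ∀ i j g a, u i j (A.act g a) = B.act g (u i j a)) {f₀ f₁ : A ⟶ B}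
    (h₀ : ∀ a, f₀ a = u 0 0 a) (h₁ : ∀ a, f₁ a = u 1 1 a) : Homotopic f₀ f₁ := by
  refine ⟨rotationHom u hu, fun g a => ?_, fun a => ?_, fun a => ?_⟩
  · change ∑ i : Fin 2, ∑ j : Fin 2, _ = tensorAct B g (∑ i : Fin 2, ∑ j : Fin 2, _)
    simp only [map_sum]
    exact Finset.sum_congr rfl fun i _ => Finset.sum_congr rfl fun j _ =>
      congrArg (· ⊗ₜ[ℤ] _) (hG i j g a)
  · change evalTensor B 0 (∑ i : Fin 2, ∑ j : Fin 2, _) = _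
    have : ∀ i j : Fin 2, evalTensor B 0 (u i j a ⊗ₜ[ℤ] (rotVec i * rotVec j)) =
        u i j a ⊗ₜ[ℤ] (rotVec i 0 * rotVec j 0) := fun i j => rfl
    simp [this, rotVec_zero, h₀]
  · change evalTensor B 1 (∑ i : Fin 2, ∑ j : Fin 2, _) = _
    have : ∀ i j : Fin 2, evalTensor B 1 (u i j a ⊗ₜ[ℤ] (rotVec i * rotVec j)) =
        u i j a ⊗ₜ[ℤ] (rotVec i 1 * rotVec j 1) := fun i j => rfl
    simp [this, rotVec_one, h₁]

theorem homotopic_corners (A : GRing.{u, v} G) : Homotopic A.upperLeft A.lowerRight := by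
  refine homotopic_of_matrix_units (B := A.mat₂) (fun i j => Matrix.singleAddMonoidHom i j)
    (fun i j k l a b => ?_) (fun i j g a => (A.entrywise_single i j g a).symm) (fun _ => rfl)
    fun _ => rfl
  change Matrix.single i j a * Matrix.single k l b = _
  split_ifs with hjk
  · subst hjk
    exact Matrix.single_mul_single_same ..
  · exact Matrix.single_mul_single_of_ne _ _ _ _ hjk _

theorem map_upperLeft (A : GRing.{u, v} G) :
    (GK.ι G).map A.upperLeft = (GK.ι G).map A.lowerRight :=
  GK.map_eq_of_homotopic (homotopic_corners A)

end Rotation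

/-! ### Level-0 morphisms as differences, and differences as double split exact sequences -/

namespace GK

variable {G : Type v} [Group G]

/-- The block diagonal embedding of `A ⊕ A` into the `2 × 2` matrices. -/
def blockDiag (A : GRing.{u, v} G) : A.prod A ⟶ A.mat₂ where
  toRingHom :=
    { toFun := fun x => Matrix.single 0 0 x.1 + Matrix.single 1 1 x.2
      map_zero' := by
        change Matrix.single 0 0 (0 : A) + Matrix.single 1 1 (0 : A) = 0
        simp
      map_add' := fun x y => by
        change Matrix.single 0 0 (x.1 + y.1) + Matrix.single 1 1 (x.2 + y.2) = _
        rw [Matrix.single_add, Matrix.single_add]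
        abel
      map_mul' := fun x y => by
        change Matrix.single 0 0 (x.1 * y.1) + Matrix.single 1 1 (x.2 * y.2) =
          (Matrix.single 0 0 x.1 + Matrix.single 1 1 x.2) *
            (Matrix.single 0 0 y.1 + Matrix.single 1 1 y.2)
        simp [add_mul, mul_add] }
  equivariant g x := by
    change Matrix.single 0 0 (A.act g x.1) + Matrix.single 1 1 (A.act g x.2) =
      A.entrywise g (Matrix.single 0 0 x.1 + Matrix.single 1 1 x.2)
    rw [map_add, GRing.entrywise_single, GRing.entrywise_single]

/-- In `M₂(B)` a sum of homomorphisms becomes one homomorphism, `diag(h, k)`. The biproduct relation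
splits it into its two corners, and rotation identifies the lower right corner with the upper left
one. -/
theorem map_lift_blockDiag {A B : GRing.{u, v} G} (h k : A ⟶ B) :
    (ι G).map (GRing.lift h k ≫ blockDiag B) =
      (ι G).map h ≫ (ι G).map B.upperLeft + (ι G).map k ≫ (ι G).map B.upperLeft := by
  have e : (ι G).map (GRing.lift h k ≫ blockDiag B) =
      (ι G).map (GRing.lift h k) ≫ 𝟙 _ ≫ (ι G).map (blockDiag B) := by
    rw [Category.id_comp, ← Functor.map_comp]
  have e₁ : B.inl B ≫ blockDiag B = B.upperLeft := GRing.hom_ext fun b => by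
    change (Matrix.single 0 0 b + Matrix.single 1 1 0 : Matrix (Fin 2) (Fin 2) B) = Matrix.single 0 0 b
    simp
  have e₂ : B.inr B ≫ blockDiag B = B.lowerRight := GRing.hom_ext fun b => by
    change (Matrix.single 0 0 0 + Matrix.single 1 1 b : Matrix (Fin 2) (Fin 2) B) = Matrix.single 1 1 b
    simp
  have e₃ : GRing.lift h k ≫ B.fst B = h := rfl
  have e₄ : GRing.lift h k ≫ B.snd B = k := rfl
  rw [e, biproduct, Preadditive.add_comp, Preadditive.comp_add, Category.assoc, Category.assoc,
    ← Functor.map_comp (ι G) (B.inl B), ← Functor.map_comp (ι G) (B.inr B), e₁, e₂,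
    ← Functor.map_comp_assoc, ← Functor.map_comp_assoc, e₃, e₄, map_upperLeft]

theorem levelZero_eq_closure (A B : GRing.{u, v} G) :
    levelZero ((ι G).obj A) ((ι G).obj B) =
      AddSubgroup.closure (Set.range fun f : A ⟶ B => (ι G).map f) := by
  refine congrArg AddSubgroup.closure (Set.ext fun x => ?_)
  exact ⟨fun ⟨f, h⟩ => ⟨f, h.symm⟩, fun ⟨f, h⟩ => ⟨f, h.symm⟩⟩

/-- Generators are added one at a time. Each step passes to `2 × 2` matrices and absorbs the new
homomorphism as a diagonal block into `h` or `k`, according to its sign. -/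
theorem exists_eq_sub_of_levelZero {A B : GRing.{u, v} G}
    (z : (ι G).obj A ⟶ (ι G).obj B) (hz : z ∈ levelZero ((ι G).obj A) ((ι G).obj B)) :
    ∃ (D : GRing.{u, v} G) (c : B ⟶ D), IsIso ((ι G).map c) ∧
      ∃ h k : A ⟶ D, z ≫ (ι G).map c = (ι G).map h - (ι G).map k := by
  rw [levelZero_eq_closure] at hz
  induction hz using AddSubgroup.closure_induction_left with
  | zero => exact ⟨B, 𝟙 B, inferInstance, GRing.zeroHom _ _, GRing.zeroHom _ _, by
      rw [sub_self]; exact Limits.zero_comp⟩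
  | add_left x hx y _ ih =>
    obtain ⟨f, rfl⟩ := hx
    obtain ⟨D, c, hc, h, k, e⟩ := ih
    refine ⟨D.mat₂, c ≫ D.upperLeft, ?_, GRing.lift (f ≫ c) h ≫ blockDiag D,
      k ≫ D.upperLeft, ?_⟩
    · rw [Functor.map_comp]; infer_instance
    · rw [map_lift_blockDiag, Functor.map_comp, ← Category.assoc, Preadditive.add_comp, e,
        Functor.map_comp, Functor.map_comp, Preadditive.add_comp, Preadditive.sub_comp,
        add_sub_assoc]
  | neg_add_cancel x hx y _ ih =>
    obtain ⟨f, rfl⟩ := hx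
    obtain ⟨D, c, hc, h, k, e⟩ := ih
    refine ⟨D.mat₂, c ≫ D.upperLeft, ?_, h ≫ D.upperLeft,
      GRing.lift (f ≫ c) k ≫ blockDiag D, ?_⟩
    · rw [Functor.map_comp]; infer_instance
    · rw [map_lift_blockDiag, Functor.map_comp, ← Category.assoc, Preadditive.add_comp, e,
        Functor.map_comp, Functor.map_comp, Preadditive.add_comp, Preadditive.sub_comp,
        Preadditive.neg_comp, Preadditive.neg_comp]
      abel

/-- The split exact sequence `B → B ⊕ A → A` with split `(k, id)`. -/
def graphSplit {A B : GRing.{u, v} G} (k : A ⟶ B) : SplitExact B (B.prod A) A where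
  j := B.inl A
  f := B.snd A
  s := GRing.lift k (𝟙 A)
  injective _ _ h := congrArg Prod.fst h
  exact m := ⟨fun h => ⟨m.1, Prod.ext rfl h.symm⟩, by rintro ⟨b, rfl⟩; rfl⟩
  split := rfl

/-- The inclusion of `B` is split by the projection `p` to `B`, so `Δ = Δ j p = (1 - f s) p`. -/
theorem Δ_graphSplit {A B : GRing.{u, v} G} (k : A ⟶ B) :
    Δ (graphSplit k) = (ι G).map (B.fst A) - (ι G).map (B.snd A) ≫ (ι G).map k := by
  have e : B.inl A ≫ B.fst A = 𝟙 B := rfl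
  calc Δ (graphSplit k) = (Δ (graphSplit k) ≫ (ι G).map (B.inl A)) ≫ (ι G).map (B.fst A) := by
        rw [Category.assoc, ← Functor.map_comp, e]
        exact (Category.comp_id _).symm
    _ = _ := by
        rw [show Δ (graphSplit k) ≫ (ι G).map (B.inl A) = _ from Δ_comp_j (graphSplit k),
          Preadditive.sub_comp, Category.id_comp, Category.assoc, ← Functor.map_comp (ι G) _ (B.fst A)]
        rfl

/-- The double split exact sequence of a pair of homomorphisms. -/
def graphDoubleSplit {A B : GRing.{u, v} G} (h k : A ⟶ B) : DoubleSplit B (B.prod A) A where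
  toSplitExact := graphSplit k
  δ := (B.prod A).act
  t := GRing.lift h (𝟙 A)
  split_t _ := rfl
  θ := (B.prod A).entrywise
  e₁₁_equivariant g m := (B.prod A).entrywise_single 0 0 g m
  e₂₂_equivariant g m := (B.prod A).entrywise_single 1 1 g m
  f_equivariant _ _ := rfl

/-- Since the action on matrices is entrywise, rotation gives `e₂₂ = e₁₁` in `GK^G`, so `μ = 1`.
What is left is `(h, 1)` followed by the split computed in `Δ_graphSplit`. -/
theorem toGK_graphDoubleSplit {A B : GRing.{u, v} G} (h k : A ⟶ B) :
    (graphDoubleSplit h k).toGK = (ι G).map h - (ι G).map k := by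
  have hμ : (graphDoubleSplit h k).μ = 𝟙 ((ι G).obj (B.prod A)) := by
    refine (IsIso.comp_inv_eq _).2 ?_
    exact (map_upperLeft (B.prod A)).symm.trans (Category.id_comp _).symm
  rw [DoubleSplit.toGK, hμ]
  change (ι G).map (GRing.lift h (𝟙 A)) ≫ 𝟙 _ ≫ Δ (graphSplit k) = _
  rw [Category.id_comp, Δ_graphSplit, Preadditive.comp_sub, ← Functor.map_comp,
    ← Functor.map_comp, ← Functor.map_comp]
  rfl

/-- Padding: identity factors lengthen a word without changing its value. -/
theorem isWord_succ {A B : GK.{u, v} G} {x : A ⟶ B} (hx : IsExtendedDoubleSplit x)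
    (h : IsExtendedDoubleSplit (𝟙 B)) (n : ℕ) : IsWord (n + 1) x := by
  have h1 : ∀ n, IsWord (n + 1) (𝟙 B) := by
    intro n
    induction n with
    | zero => exact .single h
    | succ n ih =>
      have := IsWord.cons h ih
      rwa [Category.comp_id] at this
  cases n with
  | zero => exact .single hx
  | succ n =>
    have := IsWord.cons hx (h1 n)
    rwa [Category.comp_id] at this

end GK

/-! ### Compact operators on `E ⊕ C` -/

namespace FunctionalModule

variable {G : Type v} [Group G]

section Corner

variable {C : GRing.{u, v} G} (E : FunctionalModule C)

/-- The module is spanned by its multiples. -/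
def Spanned : Prop :=
  ∀ ξ : E, ξ ∈ AddSubgroup.closure {x : E | ∃ (ζ : E) (a : C), x = E.smul ζ a}

theorem Cofull.spanned {E : FunctionalModule C} (hE : E.Cofull) : E.Spanned := fun ξ => by
  refine AddSubgroup.closure_mono ?_ (hE ξ)
  rintro _ ⟨ζ, η, φ, -, rfl⟩
  exact ⟨ζ, _, rfl⟩

/-- The module `E ⊕ C`. -/
noncomputable def withRing : FunctionalModule C := cornerModule E

/-- The functionals on the summand `C` alone produce all multiples of vectors, so nothing is asked
of the functionals of `E`. -/
theorem cofull_withRing {E : FunctionalModule C} (hE : E.Spanned) : E.withRing.Cofull :=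
  cofull_cornerModule E hE

/-- The elements of `E ⊕ C`. -/
noncomputable def pair (x : E) (c : C) : E.withRing :=
  ((x, (c, (0 : zeroModule C))) : E × (C × zeroModule C))

/-- The projection `E ⊕ C → E`. -/
noncomputable def projOne : E.withRing →+ E :=
  AddMonoidHom.fst E (C × zeroModule C)

/-- The projection `E ⊕ C → C`. -/
noncomputable def projTwo : E.withRing →+ C :=
  (AddMonoidHom.fst C (zeroModule C)).comp (AddMonoidHom.snd E (C × zeroModule C))

theorem pair_add (x y : E) (c d : C) : E.pair (x + y) (c + d) = E.pair x c + E.pair y d :=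
  Prod.ext rfl (Prod.ext rfl (Subsingleton.elim _ _))

theorem pair_eta (x : E.withRing) : E.pair (E.projOne x) (E.projTwo x) = x :=
  Prod.ext rfl (Prod.ext rfl (Subsingleton.elim _ _))

theorem smul_pair (x : E) (c d : C) :
    E.withRing.smul (E.pair x c) d = E.pair (E.smul x d) (c * d) :=
  Prod.ext rfl (Prod.ext rfl (Subsingleton.elim _ _))

theorem act_pair (g : G) (x : E) (c : C) :
    E.withRing.act g (E.pair x c) = E.pair (E.act g x) (C.act g c) :=
  Prod.ext rfl (Prod.ext rfl (Subsingleton.elim _ _))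

theorem mem_functionals_withRing (χ : E.withRing →+ C) : χ ∈ E.withRing.functionals ↔
    ∃ φ ∈ E.functionals, ∃ c : C, ∀ x d, χ (E.pair x d) = φ x + c * d := by
  refine (mem_functionals_cornerModule E χ).trans ?_
  refine exists_congr fun φ => and_congr_right fun _ => exists_congr fun c => ?_
  refine ⟨fun h x d => h x d 0, fun h x d η => ?_⟩
  rw [Subsingleton.elim η 0]
  exact h x d

/-- An operator on `E ⊕ C` given by its two components. -/
noncomputable def opPair (S : E × C →+ E) (R : E × C →+ C) : AddMonoid.End E.withRing :=
  AddMonoidHom.mk' (fun x => E.pair (S (E.projOne x, E.projTwo x)) (R (E.projOne x, E.projTwo x)))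
    fun x y => by
      rw [← pair_add, ← map_add, ← map_add, map_add, map_add]
      rfl

theorem end_ext {S T : AddMonoid.End E.withRing}
    (h : ∀ x c, S (E.pair x c) = T (E.pair x c)) : S = T :=
  AddMonoidHom.ext fun x => by rw [← E.pair_eta x]; exact h _ _

theorem mem_compact_of_eq {T : AddMonoid.End E.withRing} (x₀ : E) (c₀ : C) (φ : E →+ C)
    (hφ : φ ∈ E.functionals) (b : C)
    (h : ∀ x c, T (E.pair x c) = E.withRing.smul (E.pair x₀ c₀) (φ x + b * c)) :
    T ∈ E.withRing.compact := by
  refine AddSubgroup.subset_closure ⟨E.pair x₀ c₀,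
    φ.comp E.projOne + (AddMonoidHom.mulLeft b).comp E.projTwo, ?_, E.end_ext h⟩
  rw [mem_functionals_withRing]
  exact ⟨φ, hφ, b, fun _ _ => rfl⟩

/-- Left multiplication on the coordinate `C`. -/
noncomputable def leftOp : C →+ AddMonoid.End E.withRing := leftMul E

theorem leftOp_pair (a : C) (x : E) (c : C) : E.leftOp a (E.pair x c) = E.pair 0 (a * c) := rfl

/-- Left multiplication by a product `b c` is the elementary operator with vector `b` and functional
`c`; quadratik rings have only sums of products. -/
theorem leftOp_mem_compact (a : C) : E.leftOp a ∈ E.withRing.compact := by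
  refine AddSubgroup.closure_le (K := (AddSubgroup.closure E.withRing.elementary).comap
    E.leftOp) |>.2 ?_ (C.quadratik a)
  rintro _ ⟨b, c, rfl⟩
  refine E.mem_compact_of_eq 0 b 0 (zero_mem _) c fun x d => ?_
  rw [leftOp_pair, smul_pair, map_zero, AddMonoidHom.zero_apply, AddMonoidHom.zero_apply, zero_add,
    mul_assoc]

/-- The corner embedding of `C` into the compact operators on `E ⊕ C`. -/
noncomputable def cornerHom (hE : E.Spanned) :
    C ⟶ E.withRing.compactRing (cofull_withRing hE) :=
  ⟨{ toFun := fun a => ⟨E.leftOp a, E.leftOp_mem_compact a⟩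
     map_zero' := Subtype.ext (map_zero _)
     map_add' := fun a b => Subtype.ext (map_add _ a b)
     map_mul' := fun a b => Subtype.ext (E.end_ext fun x c => by
       change E.pair 0 (a * b * c) = E.pair 0 (a * (b * c))
       rw [mul_assoc]) },
   fun g a => Subtype.ext (E.end_ext fun x c => by
     change E.leftOp (C.act g a) (E.pair x c) = E.withRing.conj g (E.leftOp a) (E.pair x c)
     rw [conj_apply, act_pair, leftOp_pair, leftOp_pair, act_pair, map_zero, map_mul,
       ← GRing.act_mul, mul_inv_cancel, GRing.act_one])⟩

theorem isCornerEmbedding_cornerHom (hE : E.Spanned) : IsCornerEmbedding (E.cornerHom hE) :=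
  ⟨E, PEmpty, zeroAction C, cofull_withRing hE, Iso.refl _, fun _ _ _ _ => rfl⟩

/-- The operator `T ⊕ 0` on `E ⊕ C`. -/
noncomputable def ampl : AddMonoid.End E →ₙ+* AddMonoid.End E.withRing where
  toFun T := E.opPair (T.comp (AddMonoidHom.fst E C)) 0
  map_zero' := E.end_ext fun _ _ => rfl
  map_add' S T := E.end_ext fun x c => by
    refine Eq.trans ?_ (E.pair_add (S x) (T x) 0 0)
    rw [add_zero]
    rfl
  map_mul' S T := E.end_ext fun _ _ => rfl

theorem ampl_pair (T : AddMonoid.End E) (x : E) (c : C) :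
    E.ampl T (E.pair x c) = E.pair (T x) 0 := rfl

theorem conj_ampl (g : G) (T : AddMonoid.End E) :
    E.withRing.conj g (E.ampl T) = E.ampl (E.conj g T) := E.end_ext fun x c => by
  rw [conj_apply, act_pair, ampl_pair, ampl_pair, act_pair, map_zero, conj_apply]

/-- A linear `T` satisfies `T θ(η, φ) = θ(T η, φ)`. Together with `mul_ampl_mem`, where `θ(η, χ) T =
θ(η, χ T)`, this makes `T ⊕ 0` a multiplier of the compact operators, as the semidirect product
requires. -/
theorem ampl_mul_mem {T : AddMonoid.End E} (hT : ∀ x c, T (E.smul x c) = E.smul (T x) c)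
    {S : AddMonoid.End E.withRing} (hS : S ∈ E.withRing.compact) :
    E.ampl T * S ∈ E.withRing.compact := by
  refine AddSubgroup.closure_le (K := (AddSubgroup.closure E.withRing.elementary).comap
    (AddMonoidHom.mulLeft (E.ampl T))) |>.2 ?_ hS
  rintro _ ⟨η, φ, hφ, rfl⟩
  refine AddSubgroup.subset_closure ⟨E.ampl T η, φ, hφ, AddMonoidHom.ext fun x => ?_⟩
  change E.ampl T (E.withRing.smul η (φ x)) = E.withRing.smul (E.ampl T η) (φ x)
  rw [← E.pair_eta η, smul_pair, ampl_pair, ampl_pair, smul_pair, hT, zero_mul]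

theorem mul_ampl_mem {T : AddMonoid.End E} (hT : ∀ φ ∈ E.functionals, φ.comp T ∈ E.functionals)
    {S : AddMonoid.End E.withRing} (hS : S ∈ E.withRing.compact) :
    S * E.ampl T ∈ E.withRing.compact := by
  refine AddSubgroup.closure_le (K := (AddSubgroup.closure E.withRing.elementary).comap
    (AddMonoidHom.mulRight (E.ampl T))) |>.2 ?_ hS
  rintro _ ⟨η, χ, hχ, rfl⟩
  obtain ⟨φ, hφ, c, h⟩ := (E.mem_functionals_withRing _).1 hχ
  refine AddSubgroup.subset_closure ⟨η, χ.comp (E.ampl T), ?_, rfl⟩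
  rw [mem_functionals_withRing]
  refine ⟨φ.comp T, hT φ hφ, 0, fun x b => ?_⟩
  refine (h (T x) 0).trans ?_
  rw [mul_zero, zero_mul]
  rfl

end Corner

/-! ### Base change of a functional module along a homomorphism -/

section Push

variable {A C : GRing.{u, v} G} (φ : A ⟶ C) (F : FunctionalModule A)

/-- The elementary tensor `ξ ⊗ c`, as a function on the functionals of `F`. -/
def tensorGen : F →+ C →+ (F.functionals →+ C) :=
  AddMonoidHom.mk' (fun ξ => AddMonoidHom.mk'
      (fun c => AddMonoidHom.mk' (fun ψ => φ (ψ.1 ξ) * c) fun ψ χ => by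
        change φ (ψ.1 ξ + χ.1 ξ) * c = _
        rw [map_add, add_mul])
      fun c d => AddMonoidHom.ext fun ψ => mul_add _ c d)
    fun ξ ζ => AddMonoidHom.ext fun c => AddMonoidHom.ext fun ψ => by
      change φ (ψ.1 (ξ + ζ)) * c = φ (ψ.1 ξ) * c + φ (ψ.1 ζ) * c
      rw [map_add, map_add, add_mul]

/-- The additive group spanned by the elementary tensors. -/
def pushCarrier : AddSubgroup (F.functionals →+ C) :=
  AddSubgroup.closure {x | ∃ ξ c, x = tensorGen φ F ξ c}

/-- The `G`-action on the functionals. -/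
def functionalAct (g : G) : F.functionals →+ F.functionals :=
  AddMonoidHom.mk' (fun ψ => ⟨((A.act g : A →+ A).comp ψ.1).comp (F.act g⁻¹), F.conj_mem g ψ.1 ψ.2⟩)
    fun _ _ => Subtype.ext (AddMonoidHom.ext fun _ => map_add (A.act g) _ _)

theorem functionalAct_apply (g : G) (ψ : F.functionals) (ξ : F) :
    (F.functionalAct g ψ).1 ξ = A.act g (ψ.1 (F.act g⁻¹ ξ)) := rfl

/-- Left multiplication on the functionals. -/
def functionalMul (a : A) (ψ : F.functionals) : F.functionals :=
  ⟨(AddMonoidHom.mulLeft a).comp ψ.1, F.mul_mem a ψ.1 ψ.2⟩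

variable {φ F} in
theorem map_mem_pushCarrier {L : (F.functionals →+ C) →+ (F.functionals →+ C)}
    (hL : ∀ ξ c, L (tensorGen φ F ξ c) ∈ pushCarrier φ F) {x : F.functionals →+ C}
    (hx : x ∈ pushCarrier φ F) : L x ∈ pushCarrier φ F := by
  refine AddSubgroup.closure_le (K := (pushCarrier φ F).comap L) |>.2 ?_ hx
  rintro _ ⟨ξ, c, rfl⟩
  exact hL ξ c

variable {φ F} in
/-- Restriction of an operator to the span of the elementary tensors. -/
def pushRestrict (L : (F.functionals →+ C) →+ (F.functionals →+ C))
    (hL : ∀ ξ c, L (tensorGen φ F ξ c) ∈ pushCarrier φ F) : pushCarrier φ F →+ pushCarrier φ F :=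
  (L.comp (pushCarrier φ F).subtype).codRestrict _ fun x => map_mem_pushCarrier hL x.2

variable {φ F} in
theorem push_ext {x y : pushCarrier φ F} (h : ∀ ψ, x.1 ψ = y.1 ψ) : x = y :=
  Subtype.ext (AddMonoidHom.ext h)

/-- Right multiplication on functions. -/
def rightMul : C →+ (F.functionals →+ C) →+ (F.functionals →+ C) :=
  AddMonoidHom.mk' (fun c => AddMonoidHom.compHom (AddMonoidHom.mulRight c))
    fun c d => AddMonoidHom.ext fun x => AddMonoidHom.ext fun ψ => mul_add (x ψ) c d

theorem rightMul_tensorGen (c d : C) (ξ : F) :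
    rightMul F c (tensorGen φ F ξ d) = tensorGen φ F ξ (d * c) :=
  AddMonoidHom.ext fun _ => mul_assoc _ _ _

/-- The `G`-action on functions. -/
def functionAct (C : GRing.{u, v} G) (g : G) : (F.functionals →+ C) →+ (F.functionals →+ C) :=
  AddMonoidHom.mk' (fun x => ((C.act g : C →+ C).comp x).comp (F.functionalAct g⁻¹))
    fun _ _ => AddMonoidHom.ext fun _ => map_add (C.act g) _ _

theorem functionAct_tensorGen (g : G) (ξ : F) (c : C) :
    functionAct F C g (tensorGen φ F ξ c) = tensorGen φ F (F.act g ξ) (C.act g c) :=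
  AddMonoidHom.ext fun ψ => by
    change C.act g (φ ((F.functionalAct g⁻¹ ψ).1 ξ) * c) = φ (ψ.1 (F.act g ξ)) * C.act g c
    rw [functionalAct_apply, map_mul, ← φ.equivariant, ← GRing.act_mul, mul_inv_cancel,
      GRing.act_one, inv_inv]

theorem functionalAct_one (ψ : F.functionals) : F.functionalAct 1 ψ = ψ :=
  Subtype.ext (AddMonoidHom.ext fun ξ => by
    rw [functionalAct_apply, inv_one, F.act_one, A.act_one])

theorem functionalAct_mul (g h : G) (ψ : F.functionals) :
    F.functionalAct (g * h) ψ = F.functionalAct g (F.functionalAct h ψ) :=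
  Subtype.ext (AddMonoidHom.ext fun ξ => by
    simp only [functionalAct_apply, mul_inv_rev, F.act_mul, A.act_mul])

/-- The right action of `C` on the span of the elementary tensors. -/
def pushSmul : pushCarrier φ F →+ C →+ pushCarrier φ F :=
  AddMonoidHom.flip (AddMonoidHom.mk' (fun c => pushRestrict (rightMul F c) fun ξ d => by
      rw [rightMul_tensorGen]; exact AddSubgroup.subset_closure ⟨_, _, rfl⟩)
    fun c d => AddMonoidHom.ext fun x => push_ext fun ψ => mul_add (x.1 ψ) c d)

theorem pushSmul_apply (x : pushCarrier φ F) (c : C) (ψ : F.functionals) :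
    (pushSmul φ F x c).1 ψ = x.1 ψ * c := rfl

/-- The action of `G` on the span of the elementary tensors. -/
def pushAct (g : G) : pushCarrier φ F →+ pushCarrier φ F :=
  pushRestrict (functionAct F C g) fun ξ d => by
    rw [functionAct_tensorGen]; exact AddSubgroup.subset_closure ⟨_, _, rfl⟩

theorem pushAct_apply (g : G) (x : pushCarrier φ F) (ψ : F.functionals) :
    (pushAct φ F g x).1 ψ = C.act g (x.1 (F.functionalAct g⁻¹ ψ)) := rfl

theorem pushAct_smul (g : G) (x : pushCarrier φ F) (c : C) :
    pushAct φ F g (pushSmul φ F x c) = pushSmul φ F (pushAct φ F g x) (C.act g c) :=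
  push_ext fun ψ => by
    rw [pushAct_apply, pushSmul_apply, pushSmul_apply, pushAct_apply, map_mul]

theorem pushSmul_mul (x : pushCarrier φ F) (c d : C) :
    pushSmul φ F x (c * d) = pushSmul φ F (pushSmul φ F x c) d :=
  push_ext fun ψ => by rw [pushSmul_apply, pushSmul_apply, pushSmul_apply, mul_assoc]

theorem pushAct_one (x : pushCarrier φ F) : pushAct φ F 1 x = x := push_ext fun ψ => by
  rw [pushAct_apply, C.act_one, inv_one, functionalAct_one]

theorem pushAct_mul (g h : G) (x : pushCarrier φ F) :
    pushAct φ F (g * h) x = pushAct φ F g (pushAct φ F h x) := push_ext fun ψ => by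
  rw [pushAct_apply, pushAct_apply, pushAct_apply, C.act_mul, mul_inv_rev, functionalAct_mul]

/-- The `C`-linear functionals on the span of the elementary tensors. -/
def pushFunctionals : AddSubgroup (pushCarrier φ F →+ C) where
  carrier := {χ | ∀ (x : pushCarrier φ F) (c : C), χ (pushSmul φ F x c) = χ x * c}
  zero_mem' := fun _ c => (zero_mul c).symm
  add_mem' := fun {χ χ'} h h' x c =>
    (congrArg₂ (· + ·) (h x c) (h' x c)).trans (add_mul (χ x) (χ' x) c).symm
  neg_mem' := fun {χ} h x c => (congrArg Neg.neg (h x c)).trans (neg_mul (χ x) c).symm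

theorem mulLeft_comp_mem_pushFunctionals (b : C) (χ : pushCarrier φ F →+ C)
    (h : χ ∈ pushFunctionals φ F) : (AddMonoidHom.mulLeft b).comp χ ∈ pushFunctionals φ F :=
  fun x c => by
    change b * χ _ = b * χ x * c
    rw [h, mul_assoc]

theorem conj_mem_pushFunctionals (g : G) (χ : pushCarrier φ F →+ C)
    (h : χ ∈ pushFunctionals φ F) :
    ((C.act g : C →+ C).comp χ).comp (pushAct φ F g⁻¹) ∈ pushFunctionals φ F := fun x c => by
  change C.act g (χ (pushAct φ F g⁻¹ (pushSmul φ F x c))) =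
    C.act g (χ (pushAct φ F g⁻¹ x)) * c
  rw [pushAct_smul, h, map_mul, ← C.act_mul, mul_inv_cancel, C.act_one]

/-- The right functional module `F ⊗_A C`, modulo the elements on which the functionals of `F`
vanish, with all `C`-linear functionals. -/
def push : FunctionalModule C where
  carrier := pushCarrier φ F
  smul := pushSmul φ F
  smul_mul := pushSmul_mul φ F
  act := pushAct φ F
  act_one := pushAct_one φ F
  act_mul := pushAct_mul φ F
  act_smul := pushAct_smul φ F
  -- With all linear functionals admitted, evaluations at functionals of `F` and composites with `T
  -- ⊗ 1` qualify at once. Cofullness does not depend on this choice, since the summand `C` is added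
  -- later.
  functionals := pushFunctionals φ F
  map_smul _ h := h
  mul_mem := mulLeft_comp_mem_pushFunctionals φ F
  conj_mem := conj_mem_pushFunctionals φ F

/-- The elementary tensors in `push φ F`. -/
def tmul (ξ : F) (c : C) : push φ F := ⟨tensorGen φ F ξ c, AddSubgroup.subset_closure ⟨_, _, rfl⟩⟩

theorem tmul_apply (ξ : F) (c : C) (ψ : F.functionals) :
    (tmul φ F ξ c).1 ψ = φ (ψ.1 ξ) * c := rfl

theorem tmul_add (ξ : F) (c d : C) : tmul φ F ξ (c + d) = tmul φ F ξ c + tmul φ F ξ d :=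
  Subtype.ext (map_add _ c d)

theorem add_tmul (ξ ζ : F) (c : C) : tmul φ F (ξ + ζ) c = tmul φ F ξ c + tmul φ F ζ c :=
  Subtype.ext (congrArg (fun L : C →+ _ => L c) (map_add (tensorGen φ F) ξ ζ))

theorem smul_tmul (ξ : F) (c d : C) : (push φ F).smul (tmul φ F ξ c) d = tmul φ F ξ (c * d) :=
  push_ext fun _ => mul_assoc _ c d

theorem tmul_smul (ξ : F) (a : A) (c : C) :
    tmul φ F (F.smul ξ a) c = tmul φ F ξ (φ a * c) := push_ext fun ψ => by
  rw [tmul_apply, tmul_apply, F.map_smul _ ψ.2, map_mul, mul_assoc]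

theorem act_tmul (g : G) (ξ : F) (c : C) :
    (push φ F).act g (tmul φ F ξ c) = tmul φ F (F.act g ξ) (C.act g c) :=
  Subtype.ext (functionAct_tensorGen φ F g ξ c)

variable {φ F} in
theorem push_induction {p : push φ F → Prop} (x : push φ F) (h : ∀ ξ c, p (tmul φ F ξ c))
    (zero : p 0) (add : ∀ x y, p x → p y → p (x + y)) (neg : ∀ x, p x → p (-x)) : p x := by
  obtain ⟨x, hx⟩ := x
  induction hx using AddSubgroup.closure_induction with
  | mem x hx =>
    obtain ⟨ξ, c, rfl⟩ := hx
    exact h ξ c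
  | zero => exact zero
  | add x y hx hy h₁ h₂ => exact add _ _ h₁ h₂
  | neg x hx h₁ => exact neg _ h₁

variable {φ F} in
-- The elements of `push φ F` are `A`-linear in the functional, because elementary tensors are. This
-- is what moves scalars of `A` across the tensor sign.
theorem push_functionalMul (x : push φ F) (a : A) (ψ : F.functionals) :
    x.1 (F.functionalMul a ψ) = φ a * x.1 ψ := by
  induction x using push_induction with
  | h ξ c =>
    change φ (a * ψ.1 ξ) * c = φ a * (φ (ψ.1 ξ) * c)
    rw [map_mul, mul_assoc]
  | zero => exact (mul_zero _).symm
  | add x y hx hy =>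
    change x.1 _ + y.1 _ = φ a * (x.1 ψ + y.1 ψ)
    rw [hx, hy, mul_add]
  | neg x hx =>
    change -x.1 _ = φ a * -x.1 ψ
    rw [hx, mul_neg]

theorem spanned_push : (push φ F).Spanned := fun x => by
  induction x using push_induction with
  | zero => exact zero_mem _
  | add x y hx hy => exact add_mem hx hy
  | neg x hx => exact neg_mem hx
  | h ξ c =>
    refine AddSubgroup.closure_le (K := (AddSubgroup.closure
      {x : push φ F | ∃ (ζ : push φ F) (a : C), x = (push φ F).smul ζ a}).comap
        (AddMonoidHom.mk' (tmul φ F ξ) (tmul_add φ F ξ))) |>.2 ?_ (C.quadratik c)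
    rintro _ ⟨c, d, rfl⟩
    exact AddSubgroup.subset_closure ⟨tmul φ F ξ c, d, (smul_tmul φ F ξ c d).symm⟩

/-- Evaluation at a functional of `F`. -/
def evalAt (ψ : F.functionals) : push φ F →+ C :=
  (AddMonoidHom.eval ψ).comp (pushCarrier φ F).subtype

theorem evalAt_apply (ψ : F.functionals) (x : push φ F) : evalAt φ F ψ x = x.1 ψ := rfl

theorem evalAt_mem (ψ : F.functionals) : evalAt φ F ψ ∈ (push φ F).functionals :=
  fun _ _ => rfl

/-- The operators under which the functionals of `F` are stable. -/
def adjointable : NonUnitalSubring (AddMonoid.End F) where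
  carrier := {T | ∀ ψ ∈ F.functionals, ψ.comp T ∈ F.functionals}
  add_mem' {S T} hS hT ψ hψ := by
    convert add_mem (hS ψ hψ) (hT ψ hψ) using 1
    exact AddMonoidHom.ext fun ξ => map_add ψ _ _
  zero_mem' ψ _ := by
    convert zero_mem F.functionals using 1
    exact AddMonoidHom.ext fun ξ => map_zero ψ
  neg_mem' {S} hS ψ hψ := by
    convert neg_mem (hS ψ hψ) using 1
    exact AddMonoidHom.ext fun ξ => map_neg ψ _
  mul_mem' {S T} hS hT ψ hψ := hT _ (hS ψ hψ)

/-- For an elementary operator `ψ θ(η, χ) = ψ(η) χ`, and the functionals form a left `A`-module. -/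
theorem compact_le_adjointable : F.compact ≤ F.adjointable := by
  intro T hT
  refine AddSubgroup.closure_le (K := F.adjointable.toAddSubgroup) |>.2 ?_ hT
  rintro _ ⟨η, χ, hχ, rfl⟩ ψ hψ
  convert F.mul_mem (ψ η) χ hχ using 1
  exact AddMonoidHom.ext fun ξ => F.map_smul ψ hψ η (χ ξ)

/-- The transpose of an adjointable operator. -/
def transpose (T : F.adjointable) : F.functionals →+ F.functionals :=
  AddMonoidHom.mk' (fun ψ => ⟨ψ.1.comp T.1, T.2 ψ.1 ψ.2⟩) fun _ _ => rfl

/-- The action of the adjointable operators of `F` on `push φ F`. -/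
def pushOp : F.adjointable →ₙ+* AddMonoid.End (push φ F) where
  -- Precomposition with the transpose is well defined without `A`-linearity of `T`, which
  -- adjointability does not demand.
  toFun T := pushRestrict
    (AddMonoidHom.mk' (fun x => x.comp (F.transpose T)) fun _ _ => rfl)
    fun ξ c => AddSubgroup.subset_closure ⟨T.1 ξ, c, rfl⟩
  map_zero' := AddMonoidHom.ext fun x => push_ext fun ψ => by
    change x.1 (F.transpose 0 ψ) = 0
    convert map_zero x.1
    exact Subtype.ext (AddMonoidHom.ext fun ξ => map_zero ψ.1)
  map_add' S T := AddMonoidHom.ext fun x => push_ext fun ψ => by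
    change x.1 (F.transpose (S + T) ψ) = x.1 (F.transpose S ψ) + x.1 (F.transpose T ψ)
    rw [← map_add]
    congr 1
    exact Subtype.ext (AddMonoidHom.ext fun ξ => map_add ψ.1 _ _)
  map_mul' S T := rfl

theorem pushOp_apply (T : F.adjointable) (x : push φ F) (ψ : F.functionals) :
    (pushOp φ F T x).1 ψ = x.1 (F.transpose T ψ) := rfl

theorem pushOp_tmul (T : F.adjointable) (ξ : F) (c : C) :
    pushOp φ F T (tmul φ F ξ c) = tmul φ F (T.1 ξ) c := rfl

theorem pushOp_smul (T : F.adjointable) (x : push φ F) (c : C) :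
    pushOp φ F T ((push φ F).smul x c) = (push φ F).smul (pushOp φ F T x) c := rfl

theorem comp_pushOp_mem (T : F.adjointable) (χ : push φ F →+ C)
    (hχ : χ ∈ (push φ F).functionals) :
    χ.comp (pushOp φ F T) ∈ (push φ F).functionals := fun x (c : C) => by
  refine (congrArg χ (pushOp_smul φ F T x c)).trans ?_
  exact hχ _ _

/-- Composing `ψ` with the conjugate of `T` by `g` amounts to translating `ψ` by `g⁻¹`, composing
with `T`, and translating back. -/
theorem conj_mem_adjointable (g : G) {T : AddMonoid.End F} (hT : T ∈ F.adjointable) :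
    F.conj g T ∈ F.adjointable := fun ψ hψ => by
  have := F.conj_mem g _ (hT _ (F.conj_mem g⁻¹ ψ hψ))
  convert this using 1
  refine AddMonoidHom.ext fun ξ => ?_
  change ψ (F.act g (T (F.act g⁻¹ ξ))) =
    A.act g (A.act g⁻¹ (ψ (F.act g⁻¹⁻¹ (T (F.act g⁻¹ ξ)))))
  rw [← A.act_mul, mul_inv_cancel, A.act_one, inv_inv]

theorem pushOp_conj (g : G) (T : F.adjointable) :
    pushOp φ F ⟨F.conj g T.1, F.conj_mem_adjointable g T.2⟩ =
      (push φ F).conj g (pushOp φ F T) := by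
  refine AddMonoidHom.ext fun x => ?_
  change pushOp φ F ⟨F.conj g T.1, F.conj_mem_adjointable g T.2⟩ x =
    (push φ F).act g (pushOp φ F T ((push φ F).act g⁻¹ x))
  induction x using push_induction with
  | zero => simp only [map_zero]
  | add x y hx hy => simp only [map_add, hx, hy]
  | neg x hx => simp only [map_neg, hx]
  | h ξ c =>
    rw [act_tmul, pushOp_tmul, pushOp_tmul, act_tmul, ← C.act_mul, mul_inv_cancel, C.act_one]
    rfl

end Push

end FunctionalModule

/-! ### Base change of compact operators, and its restriction to a coordinate -/

namespace FunctionalModule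

variable {G : Type v} [Group G] {A C : GRing.{u, v} G} (φ : A ⟶ C) (F : FunctionalModule A)

theorem theta_mem_compact (η : F) {χ : F →+ A} (hχ : χ ∈ F.functionals) :
    F.theta η χ ∈ F.compact :=
  AddSubgroup.subset_closure ⟨η, χ, hχ, rfl⟩

/-- The elementary compact operators with a given functional. -/
def thetaHom (χ : F.functionals) : F →+ F.adjointable :=
  AddMonoidHom.mk' (fun η => ⟨F.theta η χ.1, F.compact_le_adjointable (F.theta_mem_compact η χ.2)⟩)
    fun η ζ => Subtype.ext (AddMonoidHom.ext fun ξ => by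
      change F.smul (η + ζ) (χ.1 ξ) = F.smul η (χ.1 ξ) + F.smul ζ (χ.1 ξ)
      rw [map_add, AddMonoidHom.add_apply])

/-- At a functional `ψ` both sides are `φ(ψ(η)) x(χ)`, by linearity of `x` in the functional. -/
theorem pushOp_thetaHom (η : F) (χ : F.functionals) (x : push φ F) :
    pushOp φ F (F.thetaHom χ η) x = tmul φ F η (evalAt φ F χ x) := push_ext fun ψ => by
  rw [pushOp_apply, tmul_apply, evalAt_apply, ← push_functionalMul]
  congr 1
  exact Subtype.ext (AddMonoidHom.ext fun ξ => F.map_smul ψ.1 ψ.2 η (χ.1 ξ))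

/-- The operator `T ⊗ 1 ⊕ 0` on `(F ⊗_A C) ⊕ C`. -/
noncomputable def pushAmpl : F.adjointable →ₙ+* AddMonoid.End (push φ F).withRing :=
  (push φ F).ampl.comp (pushOp φ F)

theorem pushAmpl_pair (T : F.adjointable) (x : push φ F) (c : C) :
    pushAmpl φ F T (pair _ x c) = pair _ (pushOp φ F T x) 0 := rfl

theorem pushAmpl_conj (g : G) (T : F.adjointable) :
    pushAmpl φ F ⟨F.conj g T.1, F.conj_mem_adjointable g T.2⟩ =
      (push φ F).withRing.conj g (pushAmpl φ F T) :=
  (congrArg (push φ F).ampl (pushOp_conj φ F g T)).trans (conj_ampl _ g _).symm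

theorem pushAmpl_thetaHom_mem (hF : F.Spanned) (η : F) (χ : F.functionals) :
    pushAmpl φ F (F.thetaHom χ η) ∈ (push φ F).withRing.compact := by
  let K : AddSubgroup F :=
    (push φ F).withRing.compact.toAddSubgroup.comap
      ((pushAmpl φ F : F.adjointable →+ _).comp (F.thetaHom χ))
  refine AddSubgroup.closure_le (K := K) |>.2 ?_ (hF η)
  rintro _ ⟨ζ, a, rfl⟩
  refine AddSubgroup.closure_le (K := K.comap (F.smul ζ)) |>.2 ?_ (A.quadratik a)
  rintro _ ⟨b, c, rfl⟩
  -- Without a unit in `C`, the map `x ↦ η ⊗ x(χ)` is not visibly of rank one. For `η = ζ b c` it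
  -- is: `b` is absorbed by the vector `ζ ⊗ φ(b)` and `c` by the functional, evaluation at `c χ`.
  refine mem_compact_of_eq _ (tmul φ F ζ (φ b)) 0 (evalAt φ F (F.functionalMul c χ))
    (evalAt_mem φ F _) 0 fun x d => ?_
  change pushAmpl φ F (F.thetaHom χ (F.smul ζ (b * c))) (pair _ x d) = _
  rw [pushAmpl_pair, pushOp_thetaHom, smul_pair, zero_mul, zero_mul, add_zero, smul_tmul, tmul_smul,
    map_mul, evalAt_apply, evalAt_apply, push_functionalMul, mul_assoc]

theorem pushAmpl_mem (hF : F.Spanned) (T : F.adjointable) (hT : T.1 ∈ F.compact) :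
    pushAmpl φ F T ∈ (push φ F).withRing.compact := by
  let K : AddSubgroup F.adjointable :=
    (push φ F).withRing.compact.toAddSubgroup.comap (pushAmpl φ F : F.adjointable →+ _)
  -- The operators with compact image live in the subtype of adjointable operators, so the closure
  -- is compared with their image under the injective inclusion.
  have h : AddSubgroup.closure F.elementary ≤
      K.map (F.adjointable.toAddSubgroup.subtype : F.adjointable →+ AddMonoid.End F) := by
    rw [AddSubgroup.closure_le]
    rintro _ ⟨η, χ, hχ, rfl⟩
    exact ⟨F.thetaHom ⟨χ, hχ⟩ η, pushAmpl_thetaHom_mem φ F hF η ⟨χ, hχ⟩, rfl⟩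
  obtain ⟨T', hT', e⟩ := h hT
  rwa [show T' = T from Subtype.ext e] at hT'

theorem cofull_push : (push φ F).withRing.Cofull :=
  cofull_withRing (spanned_push φ F)

/-- The compact operators on `(F ⊗_A C) ⊕ C`. -/
noncomputable abbrev pushRing : GRing.{u, v} G :=
  (push φ F).withRing.compactRing (cofull_push φ F)

/-- The compact operators, as adjointable operators. -/
def compactToAdjointable : F.compact →ₙ+* F.adjointable where
  toFun T := ⟨T.1, F.compact_le_adjointable T.2⟩
  map_zero' := rfl
  map_add' _ _ := rfl
  map_mul' _ _ := rfl

/-- The homomorphism `T ↦ T ⊗ 1 ⊕ 0` from the compact operators on `F` to the compact operators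
on `(F ⊗_A C) ⊕ C`. -/
noncomputable def pushHom (hF : F.Cofull) : F.compactRing hF ⟶ pushRing φ F where
  toRingHom := NonUnitalRingHom.codRestrict ((pushAmpl φ F).comp F.compactToAdjointable)
    (push φ F).withRing.compact fun T => pushAmpl_mem φ F hF.spanned _ T.2
  equivariant g T := Subtype.ext (pushAmpl_conj φ F g (F.compactToAdjointable T))

/-- A direct summand of `F` that is isomorphic to `A`. -/
structure Coordinate where
  incl : A →+ F
  proj : F →+ A
  incl_mul : ∀ a b, incl (a * b) = F.smul (incl a) b
  proj_incl : ∀ a, proj (incl a) = a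
  -- Only the left multiples of the projection are functionals: without a unit the projection itself
  -- need not be one.
  proj_mem : ∀ a, (AddMonoidHom.mulLeft a).comp proj ∈ F.functionals
  incl_act : ∀ g a, incl (A.act g a) = F.act g (incl a)
  proj_act : ∀ g ξ, proj (F.act g ξ) = A.act g (proj ξ)

namespace Coordinate

variable {F} (κ : Coordinate F)

/-- The functional `ξ ↦ a ξ_κ`. -/
def fn : A →+ F.functionals :=
  AddMonoidHom.mk' (fun a => ⟨_, κ.proj_mem a⟩) fun a b =>
    Subtype.ext (AddMonoidHom.ext fun ξ => add_mul a b (κ.proj ξ))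

theorem functionalMul_fn (a b : A) : F.functionalMul a (κ.fn b) = κ.fn (a * b) :=
  Subtype.ext (AddMonoidHom.ext fun _ => (mul_assoc a b _).symm)

/-- Left multiplication on the coordinate. -/
def op : A →+ AddMonoid.End F :=
  AddMonoidHom.mk' (fun a => κ.incl.comp ((AddMonoidHom.mulLeft a).comp κ.proj)) fun a b =>
    AddMonoidHom.ext fun ξ => by
      change κ.incl ((a + b) * _) = κ.incl (a * _) + κ.incl (b * _)
      rw [add_mul, map_add]

theorem op_act (g : G) (a : A) : κ.op (A.act g a) = F.conj g (κ.op a) :=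
  AddMonoidHom.ext fun ξ => by
    change κ.incl (A.act g a * κ.proj ξ) = F.act g (κ.incl (a * κ.proj (F.act g⁻¹ ξ)))
    rw [← incl_act, map_mul (A.act g), ← proj_act, act_act_inv]

theorem op_mem_compact (a : A) : κ.op a ∈ F.compact := by
  refine AddSubgroup.closure_le (K := F.compact.toAddSubgroup.comap κ.op) |>.2 ?_ (A.quadratik a)
  rintro _ ⟨b, c, rfl⟩
  refine AddSubgroup.subset_closure ⟨κ.incl b, (κ.fn c).1, (κ.fn c).2, AddMonoidHom.ext fun ξ => ?_⟩
  change κ.incl (b * c * κ.proj ξ) = F.smul (κ.incl b) (c * κ.proj ξ)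
  rw [mul_assoc, incl_mul]

/-- Left multiplication on the coordinate, as an adjointable operator. -/
def opAdj : A →+ F.adjointable :=
  AddMonoidHom.mk' (fun a => ⟨κ.op a, F.compact_le_adjointable (κ.op_mem_compact a)⟩)
    fun a b => Subtype.ext (map_add κ.op a b)

theorem op_mul (a b : A) : κ.op (a * b) = κ.op a * κ.op b := AddMonoidHom.ext fun ξ => by
  change κ.incl (a * b * _) = κ.incl (a * κ.proj (κ.incl (b * _)))
  rw [proj_incl, mul_assoc]

theorem opAdj_mul (a b : A) : κ.opAdj (a * b) = κ.opAdj a * κ.opAdj b :=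
  Subtype.ext (κ.op_mul a b)

/-- A product is needed: multiplication by `a b` on the coordinate is the elementary operator with
vector `a` and functional `b`. -/
theorem pushOp_opAdj_mul (a b : A) (x : push φ F) :
    pushOp φ F (κ.opAdj (a * b)) x = tmul φ F (κ.incl a) (evalAt φ F (κ.fn b) x) := by
  rw [← pushOp_thetaHom]
  congr 2
  refine Subtype.ext (AddMonoidHom.ext fun ξ => ?_)
  change κ.incl (a * b * _) = F.smul (κ.incl a) (b * _)
  rw [← incl_mul, mul_assoc]

theorem evalAt_pushOp (a b : A) (x : push φ F) :
    evalAt φ F (κ.fn a) (pushOp φ F (κ.opAdj b) x) = evalAt φ F (κ.fn (a * b)) x := by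
  rw [evalAt_apply, pushOp_apply, evalAt_apply]
  congr 1
  refine Subtype.ext (AddMonoidHom.ext fun ξ => ?_)
  change a * κ.proj (κ.incl (b * _)) = a * b * _
  rw [proj_incl, mul_assoc]

theorem evalAt_tmul (a b : A) (c : C) :
    evalAt φ F (κ.fn a) (tmul φ F (κ.incl b) c) = φ (a * b) * c := by
  change φ (a * κ.proj (κ.incl b)) * c = _
  rw [proj_incl]

theorem mul_evalAt (a b : A) (x : push φ F) :
    φ a * evalAt φ F (κ.fn b) x = evalAt φ F (κ.fn (a * b)) x := by
  rw [evalAt_apply, evalAt_apply, ← functionalMul_fn, push_functionalMul]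

theorem tmul_incl_mul (a b : A) (c : C) :
    tmul φ F (κ.incl (a * b)) c = tmul φ F (κ.incl a) (φ b * c) := by
  rw [incl_mul, tmul_smul]

/-- The four blocks of the action of `2 × 2` matrices over `A` on `(F ⊗_A C) ⊕ C`. -/
noncomputable def block : Fin 2 → Fin 2 → A → AddMonoid.End (push φ F).withRing
  | 0, 0, a => pushAmpl φ F (κ.opAdj a)
  | 0, 1, a => (push φ F).opPair
      ((AddMonoidHom.mk' (tmul φ F (κ.incl a)) (tmul_add φ F _)).comp (AddMonoidHom.snd _ C)) 0
  | 1, 0, a => (push φ F).opPair 0 ((evalAt φ F (κ.fn a)).comp (AddMonoidHom.fst _ C))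
  | 1, 1, a => (push φ F).leftOp (φ a)

theorem block_zero_zero (a : A) (x : push φ F) (c : C) :
    κ.block φ 0 0 a (pair _ x c) = pair _ (pushOp φ F (κ.opAdj a) x) 0 := rfl

theorem block_zero_one (a : A) (x : push φ F) (c : C) :
    κ.block φ 0 1 a (pair _ x c) = pair _ (tmul φ F (κ.incl a) c) 0 := rfl

theorem block_one_zero (a : A) (x : push φ F) (c : C) :
    κ.block φ 1 0 a (pair _ x c) = pair _ 0 (evalAt φ F (κ.fn a) x) := rfl

theorem block_one_one (a : A) (x : push φ F) (c : C) :
    κ.block φ 1 1 a (pair _ x c) = pair _ 0 (φ a * c) := rfl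

theorem tmul_zero (ξ : F) : tmul φ F ξ 0 = 0 := map_zero (AddMonoidHom.mk' _ (tmul_add φ F ξ))

theorem pushOp_opAdj_opAdj (a b : A) (x : push φ F) :
    pushOp φ F (κ.opAdj a) (pushOp φ F (κ.opAdj b) x) = pushOp φ F (κ.opAdj (a * b)) x := by
  rw [opAdj_mul, map_mul]
  rfl

theorem pushOp_opAdj_tmul (a b : A) (c : C) :
    pushOp φ F (κ.opAdj a) (tmul φ F (κ.incl b) c) = tmul φ F (κ.incl (a * b)) c := by
  rw [pushOp_tmul]
  change tmul φ F (κ.incl (a * κ.proj (κ.incl b))) c = _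
  rw [proj_incl]

/-- The coordinate contributes a summand `A ⊗_A C` to `F ⊗_A C`, and the off-diagonal blocks
exchange it with `C`. Each of the sixteen products reduces to associativity, to the identity `proj ∘
incl = id`, or to scalars passing the tensor sign. -/
theorem block_mul (i j k l : Fin 2) (a b : A) :
    κ.block φ i j a * κ.block φ k l b = if j = k then κ.block φ i l (a * b) else 0 := by
  refine end_ext _ fun x c => ?_
  have h0 : (0 : AddMonoid.End (push φ F).withRing) (pair _ x c) =
    pair _ (0 : push φ F) (0 : C) := rfl
  have hm : ∀ S T : AddMonoid.End (push φ F).withRing,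
    (S * T) (pair _ x c) = S (T (pair _ x c)) := fun _ _ => rfl
  revert i j k l
  simp only [Fin.forall_fin_two, hm, zero_ne_one, one_ne_zero, if_true, if_false]
  refine ⟨⟨⟨⟨?_, ?_⟩, ?_, ?_⟩, ⟨?_, ?_⟩, ?_, ?_⟩, ⟨⟨?_, ?_⟩, ?_, ?_⟩, ⟨?_, ?_⟩, ?_, ?_⟩
  all_goals
    simp only [block_zero_zero, block_zero_one, block_one_zero, block_one_one, h0, map_zero,
      mul_zero, tmul_zero, pushOp_opAdj_opAdj, pushOp_opAdj_tmul, ← pushOp_opAdj_mul,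
      ← tmul_incl_mul, evalAt_pushOp, evalAt_tmul, mul_evalAt, map_mul, mul_assoc]

theorem block_add (i j : Fin 2) (a b : A) :
    κ.block φ i j (a + b) = κ.block φ i j a + κ.block φ i j b := by
  refine end_ext _ fun x c => ?_
  have hm : ∀ S T : AddMonoid.End (push φ F).withRing,
    (S + T) (pair _ x c) = S (pair _ x c) + T (pair _ x c) := fun _ _ => rfl
  have hp : ∀ S T : AddMonoid.End (push φ F), (S + T) x = S x + T x := fun _ _ => rfl
  have he : ∀ ψ χ, evalAt φ F (ψ + χ) x = evalAt φ F ψ x + evalAt φ F χ x :=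
    fun ψ χ => map_add x.1 ψ χ
  revert i j
  simp only [Fin.forall_fin_two, hm]
  refine ⟨⟨?_, ?_⟩, ?_, ?_⟩
  all_goals
    simp only [block_zero_zero, block_zero_one, block_one_zero, block_one_one, ← pair_add, map_add,
      hp, he, add_tmul, add_mul, add_zero]

theorem block_conj (g : G) (i j : Fin 2) (a : A) :
    κ.block φ i j (A.act g a) = (push φ F).withRing.conj g (κ.block φ i j a) := by
  refine end_ext _ fun x c => ?_
  have hx : (push φ F).act g ((push φ F).act g⁻¹ x) = x := act_act_inv _ g x
  have hc : C.act g (C.act g⁻¹ c) = c := by rw [← C.act_mul, mul_inv_cancel, C.act_one]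
  rw [conj_apply, act_pair]
  revert i j
  simp only [Fin.forall_fin_two]
  refine ⟨⟨?_, ?_⟩, ?_, ?_⟩
  all_goals
    simp only [block_zero_zero, block_zero_one, block_one_zero, block_one_one, act_pair, map_zero,
      act_tmul, hc, map_mul, incl_act, φ.equivariant]
  · have h : κ.opAdj (A.act g a) =
        ⟨F.conj g (κ.opAdj a).1, F.conj_mem_adjointable g (κ.opAdj a).2⟩ :=
      Subtype.ext (κ.op_act g a)
    rw [h, pushOp_conj]
    rfl
  · have h : evalAt φ F (κ.fn (A.act g a)) x =
        C.act g (evalAt φ F (κ.fn a) ((push φ F).act g⁻¹ x)) := by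
      rw [evalAt_apply, evalAt_apply]
      change _ = C.act g (C.act g⁻¹ (x.1 (F.functionalAct g⁻¹⁻¹ (κ.fn a))))
      rw [← C.act_mul, mul_inv_cancel, C.act_one, inv_inv]
      congr 1
      -- Equivariance of the projection makes the translate by `g` of the functional `a · proj`
      -- equal to `(g a) · proj`.
      refine Subtype.ext (AddMonoidHom.ext fun ξ => ?_)
      change A.act g a * κ.proj ξ = A.act g (a * κ.proj (F.act g⁻¹ ξ))
      rw [map_mul, ← proj_act, act_act_inv]
    rw [h]

/-- The blocks, as additive maps. -/
noncomputable def blockHom (i j : Fin 2) : A →+ AddMonoid.End (push φ F).withRing :=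
  AddMonoidHom.mk' (κ.block φ i j) (κ.block_add φ i j)

theorem block_mem (hF : F.Spanned) (i j : Fin 2) (a : A) :
    κ.block φ i j a ∈ (push φ F).withRing.compact := by
  have h₀₁ : κ.block φ 0 1 a ∈ (push φ F).withRing.compact := by
    let K := (push φ F).withRing.compact.toAddSubgroup.comap (κ.blockHom φ 0 1)
    refine AddSubgroup.closure_le (K := K) |>.2 ?_ (A.quadratik a)
    rintro _ ⟨b, c, rfl⟩
    -- Three factors are needed: `b` for the coordinate vector and `c` for the tensor factor in `C`,
    -- which together give the vector, and `d` for the functional on `C`.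
    refine AddSubgroup.closure_le (K := K.comap (AddMonoidHom.mulLeft b)) |>.2 ?_ (A.quadratik c)
    rintro _ ⟨c, d, rfl⟩
    refine mem_compact_of_eq _ (tmul φ F (κ.incl b) (φ c)) 0 0 (zero_mem _) (φ d) fun x e => ?_
    change κ.block φ 0 1 (b * (c * d)) (pair _ x e) = _
    rw [block_zero_one, smul_pair, zero_mul, smul_tmul, tmul_incl_mul, map_mul,
      AddMonoidHom.zero_apply, zero_add, mul_assoc]
  have h₁₀ : κ.block φ 1 0 a ∈ (push φ F).withRing.compact := by
    let K := (push φ F).withRing.compact.toAddSubgroup.comap (κ.blockHom φ 1 0)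
    refine AddSubgroup.closure_le (K := K) |>.2 ?_ (A.quadratik a)
    rintro _ ⟨b, c, rfl⟩
    refine mem_compact_of_eq _ 0 (φ b) (evalAt φ F (κ.fn c)) (evalAt_mem φ F _) 0 fun x e => ?_
    change κ.block φ 1 0 (b * c) (pair _ x e) = _
    rw [block_one_zero, smul_pair, map_zero, AddMonoidHom.zero_apply, zero_mul, add_zero,
      mul_evalAt]
  have h₀₀ : κ.block φ 0 0 a ∈ (push φ F).withRing.compact :=
    pushAmpl_mem φ F hF _ (κ.op_mem_compact a)
  have h₁₁ : κ.block φ 1 1 a ∈ (push φ F).withRing.compact := leftOp_mem_compact _ _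
  revert i j
  simp only [Fin.forall_fin_two]
  exact ⟨⟨h₀₀, h₀₁⟩, h₁₀, h₁₁⟩

end Coordinate

/-- The blocks form a system of matrix units inside the compact operators, and the two homomorphisms
are its diagonal blocks; rotation makes them homotopic. This lets `φ` pass through a corner. -/
theorem map_pushHom_eq {F : FunctionalModule A} (κ : Coordinate F) (hF : F.Cofull)
    (e : A ⟶ F.compactRing hF) (he : ∀ a, (e a).1 = κ.op a) :
    (GK.ι G).map (e ≫ pushHom φ F hF) =
      (GK.ι G).map (φ ≫ cornerHom (push φ F) (spanned_push φ F)) := by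
  let u : Fin 2 → Fin 2 → A →+ pushRing φ F := fun i j =>
    (κ.blockHom φ i j).codRestrict (push φ F).withRing.compact.toAddSubgroup
      fun a => κ.block_mem φ hF.spanned i j a
  refine GK.map_eq_of_homotopic (homotopic_of_matrix_units u ?_ ?_ ?_ ?_)
  · intro i j k l a b
    refine Subtype.ext ((κ.block_mul φ i j k l a b).trans ?_)
    split_ifs <;> rfl
  · exact fun i j g a => Subtype.ext (κ.block_conj φ g i j a)
  · intro a
    refine Subtype.ext (congrArg (pushAmpl φ F) (Subtype.ext ?_))
    exact he a
  · exact fun a => rfl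

end FunctionalModule

/-! ### Semidirect products of compact operators with a ring of multipliers -/

namespace FunctionalModule

variable {G : Type v} [Group G]

/-- The conjugation by the `G`-action, as a ring homomorphism. -/
def conjHom {C : GRing.{u, v} G} (N : FunctionalModule C) (g : G) :
    AddMonoid.End N →ₙ+* AddMonoid.End N :=
  { N.conj g with
    map_mul' := fun S T => AddMonoidHom.ext fun ξ => by
      change N.act g (S (T (N.act g⁻¹ ξ))) =
        N.act g (S (N.act g⁻¹ (N.act g (T (N.act g⁻¹ ξ)))))
      rw [act_inv_act] }

theorem conjHom_one {C : GRing.{u, v} G} (N : FunctionalModule C) (T : AddMonoid.End N) :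
    N.conjHom 1 T = T := AddMonoidHom.ext fun ξ => by
  change N.act 1 (T (N.act 1⁻¹ ξ)) = T ξ
  rw [inv_one, N.act_one, N.act_one]

theorem conjHom_mul {C : GRing.{u, v} G} (N : FunctionalModule C) (g h : G)
    (T : AddMonoid.End N) : N.conjHom (g * h) T = N.conjHom g (N.conjHom h T) :=
  AddMonoidHom.ext fun ξ => by
    change N.act (g * h) (T (N.act (g * h)⁻¹ ξ)) =
      N.act g (N.act h (T (N.act h⁻¹ (N.act g⁻¹ ξ))))
    rw [mul_inv_rev, N.act_mul, N.act_mul]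

/-- An equivariant action of the ring `A` on `N` by multipliers of the compact operators. -/
structure MultiplierAction {C : GRing.{u, v} G} (N : FunctionalModule C) (A : GRing.{u, v} G) where
  toHom : A →ₙ+* AddMonoid.End N
  mul_mem : ∀ a, ∀ T ∈ N.compact, toHom a * T ∈ N.compact
  mem_mul : ∀ a, ∀ T ∈ N.compact, T * toHom a ∈ N.compact
  map_act : ∀ g a, toHom (A.act g a) = N.conj g (toHom a)

namespace MultiplierAction

variable {A C : GRing.{u, v} G} {N : FunctionalModule C} (τ : MultiplierAction N A)

/-- The semidirect product of the compact operators on `N` and of `A`. -/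
def subring : NonUnitalSubring (AddMonoid.End N × A) where
  -- The component in `A` is recorded because some elements of `A` may act by compact operators, or
  -- by zero; the quotient map to `A` would otherwise not be defined.
  carrier := {x | x.1 - τ.toHom x.2 ∈ N.compact}
  zero_mem' := by
    change (0 : AddMonoid.End N) - τ.toHom 0 ∈ N.compact
    rw [map_zero, sub_zero]
    exact zero_mem _
  add_mem' {x y} hx hy := by
    change x.1 + y.1 - τ.toHom (x.2 + y.2) ∈ N.compact
    rw [map_add, add_sub_add_comm]
    exact add_mem hx hy
  neg_mem' {x} hx := by
    change -x.1 - τ.toHom (-x.2) ∈ N.compact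
    rw [map_neg, ← neg_sub', neg_mem_iff]
    exact hx
  mul_mem' {x y} hx hy := by
    change x.1 * y.1 - τ.toHom (x.2 * y.2) ∈ N.compact
    -- With each factor written as a compact operator plus a multiplier, the product of the
    -- multipliers cancels and the three remaining terms are compact.
    have e : x.1 * y.1 - τ.toHom (x.2 * y.2) =
        (x.1 - τ.toHom x.2) * (y.1 - τ.toHom y.2) + τ.toHom x.2 * (y.1 - τ.toHom y.2) +
          (x.1 - τ.toHom x.2) * τ.toHom y.2 := by
      rw [map_mul]
      noncomm_ring
    rw [e]
    exact add_mem (add_mem (N.compact.mul_mem hx hy) (τ.mul_mem _ _ hy)) (τ.mem_mul _ _ hx)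

theorem mem_subring {x : AddMonoid.End N × A} :
    x ∈ τ.subring ↔ x.1 - τ.toHom x.2 ∈ N.compact := Iff.rfl

/-- The inclusion of the compact operators. -/
def inclHom : N.compact →ₙ+* τ.subring where
  toFun T := ⟨(T.1, 0), by rw [mem_subring, map_zero, sub_zero]; exact T.2⟩
  map_zero' := rfl
  map_add' S T := Subtype.ext (Prod.ext rfl (add_zero 0).symm)
  map_mul' S T := Subtype.ext (Prod.ext rfl (mul_zero 0).symm)

/-- The inclusion of `A`. -/
def splitHom : A →ₙ+* τ.subring where
  toFun a := ⟨(τ.toHom a, a), by rw [mem_subring, sub_self]; exact zero_mem _⟩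
  map_zero' := Subtype.ext (Prod.ext (map_zero _) rfl)
  map_add' a b := Subtype.ext (Prod.ext (map_add _ a b) rfl)
  map_mul' a b := Subtype.ext (Prod.ext (map_mul _ a b) rfl)

theorem closure_products_map {R S : Type u} [NonUnitalRing R] [NonUnitalRing S] (f : R →ₙ+* S)
    {x : R} (hx : x ∈ AddSubgroup.closure {x : R | ∃ b c : R, x = b * c}) :
    f x ∈ AddSubgroup.closure {x : S | ∃ b c : S, x = b * c} := by
  refine AddSubgroup.closure_le (K := (AddSubgroup.closure
    {x : S | ∃ b c : S, x = b * c}).comap (f : R →+ S)) |>.2 ?_ hx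
  rintro _ ⟨b, c, rfl⟩
  exact AddSubgroup.subset_closure ⟨f b, f c, map_mul f b c⟩

/-- Each element is the sum of a compact operator and the image of an element of `A` under the
split, and both rings are quadratik. -/
theorem isQuadratik_subring (hN : N.Cofull) : IsQuadratik τ.subring := by
  intro x
  have h₁ := closure_products_map τ.inclHom (N.isQuadratik_compact hN ⟨_, x.2⟩)
  have h₂ := closure_products_map τ.splitHom (A.quadratik x.1.2)
  convert add_mem h₁ h₂ using 1
  exact Subtype.ext (Prod.ext (sub_add_cancel _ _).symm (zero_add _).symm)

theorem prodMap_mem (g : G) {x : AddMonoid.End N × A} (hx : x ∈ τ.subring) :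
    NonUnitalRingHom.prodMap (N.conjHom g) (A.act g) x ∈ τ.subring := by
  rw [mem_subring]
  change N.conj g x.1 - τ.toHom (A.act g x.2) ∈ N.compact
  rw [map_act, ← map_sub]
  exact N.conj_mem_compact g hx

/-- The semidirect product, as a `G`-ring. -/
def ring (hN : N.Cofull) : GRing.{u, v} G where
  carrier := τ.subring
  act :=
    { toFun := fun g => NonUnitalRingHom.codRestrict
        ((NonUnitalRingHom.prodMap (N.conjHom g) (A.act g)).comp
          (NonUnitalSubringClass.subtype τ.subring)) τ.subring
        fun x => τ.prodMap_mem g x.2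
      map_one' := NonUnitalRingHom.ext fun x =>
        Subtype.ext (Prod.ext (N.conjHom_one x.1.1) (A.act_one x.1.2))
      map_mul' := fun g h => NonUnitalRingHom.ext fun x =>
        Subtype.ext (Prod.ext (N.conjHom_mul g h x.1.1) (A.act_mul g h x.1.2)) }
  quadratik := τ.isQuadratik_subring hN

/-- The split exact sequence of the semidirect product. -/
def splitExact (hN : N.Cofull) : SplitExact (N.compactRing hN) (τ.ring hN) A where
  j := ⟨τ.inclHom, fun g T => Subtype.ext (Prod.ext rfl (map_zero (A.act g)).symm)⟩
  f := ⟨(NonUnitalRingHom.snd (AddMonoid.End N) A).comp (NonUnitalSubringClass.subtype τ.subring),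
    fun _ _ => rfl⟩
  s := ⟨τ.splitHom, fun g a => Subtype.ext (Prod.ext (τ.map_act g a) rfl)⟩
  injective S T h := Subtype.ext (congrArg (fun x : τ.subring => x.1.1) h)
  exact m := by
    constructor
    · intro h
      replace h : m.1.2 = 0 := h
      have hm : m.1.1 - τ.toHom m.1.2 ∈ N.compact := m.2
      rw [h, map_zero, sub_zero] at hm
      exact ⟨⟨m.1.1, hm⟩, Subtype.ext (Prod.ext rfl h.symm)⟩
    · rintro ⟨T, rfl⟩
      rfl
  split := rfl

end MultiplierAction

end FunctionalModule

/-! ### The action of the middle ring on its ideal -/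

namespace SplitExact

variable {G : Type v} [Group G] {B M A : GRing.{u, v} G} (S : SplitExact B M A)

/-- `B` is the kernel of `f`, hence an ideal. -/
theorem exists_left (m : M) (b : B) : ∃ c : B, S.j c = m * S.j b :=
  (S.exact _).1 (by rw [map_mul, (S.exact _).2 ⟨b, rfl⟩, mul_zero])

theorem exists_right (b : B) (m : M) : ∃ c : B, S.j c = S.j b * m :=
  (S.exact _).1 (by rw [map_mul, (S.exact _).2 ⟨b, rfl⟩, zero_mul])

/-- The left multiplication of elements of the ideal `B` by elements of `M`. -/
noncomputable def leftMult (m : M) (b : B) : B := (S.exists_left m b).choose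

theorem j_leftMult (m : M) (b : B) : S.j (S.leftMult m b) = m * S.j b :=
  (S.exists_left m b).choose_spec

/-- The action of `M` on its ideal `B` by left multiplication. -/
noncomputable def ideal : M →ₙ+* (self B).adjointable where
  toFun m := ⟨AddMonoidHom.mk' (S.leftMult m) fun b c => S.injective (by
      rw [j_leftMult, map_add, map_add, j_leftMult, j_leftMult, mul_add]), by
    rintro _ ⟨b, rfl⟩
    -- The functional `b` composed with left multiplication by `m` is the functional `b m`, which
    -- again lies in the ideal.
    obtain ⟨c, hc⟩ := S.exists_right b m
    refine ⟨c, AddMonoidHom.ext fun d => S.injective ?_⟩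
    change S.j (c * d) = S.j (b * S.leftMult m d)
    rw [map_mul, map_mul, j_leftMult, hc, mul_assoc]⟩
  map_zero' := Subtype.ext (AddMonoidHom.ext fun b => S.injective (by
    change S.j (S.leftMult 0 b) = S.j 0
    rw [j_leftMult, zero_mul, map_zero]))
  map_add' m n := Subtype.ext (AddMonoidHom.ext fun b => S.injective (by
    change S.j (S.leftMult (m + n) b) = S.j (S.leftMult m b + S.leftMult n b)
    rw [map_add, j_leftMult, j_leftMult, j_leftMult, add_mul]))
  map_mul' m n := Subtype.ext (AddMonoidHom.ext fun b => S.injective (by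
    change S.j (S.leftMult (m * n) b) = S.j (S.leftMult m (S.leftMult n b))
    rw [j_leftMult, j_leftMult, j_leftMult, mul_assoc]))

theorem ideal_act (g : G) (m : M) :
    S.ideal (M.act g m) =
      ⟨(self B).conj g (S.ideal m).1, (self B).conj_mem_adjointable g (S.ideal m).2⟩ :=
  Subtype.ext (AddMonoidHom.ext fun b => S.injective (by
    change S.j (S.leftMult (M.act g m) b) = S.j (B.act g (S.leftMult m (B.act g⁻¹ b)))
    rw [j_leftMult, S.j.equivariant, j_leftMult, map_mul, ← S.j.equivariant, ← B.act_mul,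
      mul_inv_cancel, B.act_one]))

end SplitExact

/-! ### Push-forward of a split exact sequence -/

namespace FunctionalModule

variable {G : Type v} [Group G]

/-- The coordinate of the module `A` over itself. -/
def selfCoordinate (A : GRing.{u, v} G) : Coordinate (self A) where
  incl := AddMonoidHom.id A
  proj := AddMonoidHom.id A
  incl_mul _ _ := rfl
  proj_incl _ := rfl
  proj_mem a := ⟨a, rfl⟩
  incl_act _ _ := rfl
  proj_act _ _ := rfl

theorem cofull_self (A : GRing.{u, v} G) : (self A).Cofull := fun a => by
  refine AddSubgroup.closure_le (K := AddSubgroup.closure _) |>.2 ?_ (A.quadratik a)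
  rintro _ ⟨b, c, rfl⟩
  refine AddSubgroup.closure_le (K := (AddSubgroup.closure _).comap (AddMonoidHom.mulLeft b)) |>.2
    ?_ (A.quadratik c)
  rintro _ ⟨c, d, rfl⟩
  -- In the product `b (c d)` the outer factors are the two vectors and `c` is the functional.
  exact AddSubgroup.subset_closure ⟨b, d, _, ⟨c, rfl⟩, rfl⟩

/-- The action of `A` on a coordinate of `F`, as a homomorphism to the compact operators. -/
def Coordinate.compactHom {A : GRing.{u, v} G} {F : FunctionalModule A} (κ : Coordinate F)
    (hF : F.Cofull) : A ⟶ F.compactRing hF :=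
  ⟨{ toFun := fun a => ⟨κ.op a, κ.op_mem_compact a⟩
     map_zero' := Subtype.ext (map_zero κ.op)
     map_add' := fun a b => Subtype.ext (map_add κ.op a b)
     map_mul' := fun a b => Subtype.ext (κ.op_mul a b) },
   fun g a => Subtype.ext (κ.op_act g a)⟩

/-- The distinguished coordinate of `E ⊕ A ⊕ ⨁_J A`. -/
noncomputable def prodCoordinate {A : GRing.{u, v} G} (E : FunctionalModule A) (J : Type u)
    (T : FreeAction A J) : Coordinate (E.prod ((self A).prod (free A J T))) where
  incl := (AddMonoidHom.inr E (A × (J →₀ A))).comp (AddMonoidHom.inl A (J →₀ A))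
  proj := (AddMonoidHom.fst A (J →₀ A)).comp (AddMonoidHom.snd E (A × (J →₀ A)))
  incl_mul _ b := Prod.ext (map_zero ((AddMonoidHom.eval b).comp E.smul)).symm
    (Prod.ext rfl (map_zero ((AddMonoidHom.eval b).comp (free A J T).smul)).symm)
  proj_incl _ := rfl
  proj_mem a := ⟨0, zero_mem _, (AddMonoidHom.mulLeft a).comp (AddMonoidHom.fst A (J →₀ A)),
    ⟨AddMonoidHom.mulLeft a, ⟨a, rfl⟩, 0, zero_mem _, AddMonoidHom.ext fun _ => (add_zero _).symm⟩,
    AddMonoidHom.ext fun _ => (zero_add _).symm⟩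
  incl_act g _ := Prod.ext (map_zero (E.act g)).symm
    (Prod.ext rfl (map_zero ((free A J T).act g)).symm)
  proj_act _ _ := rfl

/-- The action of `M` on `(B ⊗ C) ⊕ C`, for an ideal `B` of `M`, restricted to the split. -/
noncomputable def splitAction {B M A C : GRing.{u, v} G} (S : SplitExact B M A) (φ : B ⟶ C) :
    MultiplierAction (push φ (self B)).withRing A where
  toHom := ((pushAmpl φ (self B)).comp S.ideal).comp S.s.toRingHom
  mul_mem _ _ hT := ampl_mul_mem _ (pushOp_smul φ _ _) hT
  mem_mul _ _ hT := mul_ampl_mem _ (comp_pushOp_mem φ _ _) hT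
  map_act g a := by
    change pushAmpl φ (self B) (S.ideal (S.s (A.act g a))) = _
    rw [S.s.equivariant, S.ideal_act, pushAmpl_conj]
    rfl

theorem ideal_j {B M A : GRing.{u, v} G} (S : SplitExact B M A) (b : B) :
    (S.ideal (S.j b)).1 = (selfCoordinate B).op b :=
  AddMonoidHom.ext fun c => S.injective (by
    change S.j (S.leftMult (S.j b) c) = S.j (b * c)
    rw [S.j_leftMult, map_mul])

/-- The element `m - s(f(m))` comes from some `b` in `B`. It acts on `B` as left multiplication by
`b`, which is compact and stays compact after base change. -/
theorem pushAmpl_ideal_mem {B M A C : GRing.{u, v} G} (S : SplitExact B M A) (φ : B ⟶ C) (m : M) :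
    (pushAmpl φ (self B) (S.ideal m), S.f m) ∈ (splitAction S φ).subring := by
  have hf : S.f (m - S.s (S.f m)) = 0 := by
    rw [map_sub, sub_eq_zero]
    exact (congrArg (fun k : A ⟶ A => k (S.f m)) S.split).symm
  obtain ⟨b, hb⟩ := (S.exact _).1 hf
  rw [MultiplierAction.mem_subring]
  change pushAmpl φ (self B) (S.ideal m) - pushAmpl φ (self B) (S.ideal (S.s (S.f m))) ∈ _
  rw [← map_sub, ← map_sub, ← hb]
  refine pushAmpl_mem φ _ (cofull_self B).spanned _ ?_
  rw [ideal_j]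
  exact Coordinate.op_mem_compact _ _

/-- The homomorphism from `M` to the semidirect product. -/
noncomputable def toSemidirect {B M A C : GRing.{u, v} G} (S : SplitExact B M A) (φ : B ⟶ C) :
    M ⟶ (splitAction S φ).ring (cofull_push φ (self B)) where
  toRingHom := NonUnitalRingHom.codRestrict
    (NonUnitalRingHom.prod ((pushAmpl φ (self B)).comp S.ideal) S.f.toRingHom)
    (splitAction S φ).subring (pushAmpl_ideal_mem S φ)
  equivariant g m := Subtype.ext (Prod.ext (by
    change pushAmpl φ (self B) (S.ideal (M.act g m)) = _
    rw [S.ideal_act, pushAmpl_conj]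
    rfl) (S.f.equivariant g m))

/-- On the ideal, the homomorphism from `M` is base change of left multiplication. So
`map_pushHom_eq`, applied to `B` over itself, describes it in `GK^G` as `φ` followed by a corner
embedding and the inclusion of the compact operators. -/
theorem j_toSemidirect {B M A C : GRing.{u, v} G} (S : SplitExact B M A) (φ : B ⟶ C) :
    S.j ≫ toSemidirect S φ =
      ((selfCoordinate B).compactHom (cofull_self B) ≫ pushHom φ (self B) (cofull_self B)) ≫
        ((splitAction S φ).splitExact (cofull_push φ (self B))).j :=
  GRing.hom_ext fun b => Subtype.ext (Prod.ext
    (congrArg (pushAmpl φ (self B)) (Subtype.ext (ideal_j S b)))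
    ((S.exact _).2 ⟨b, rfl⟩))

end FunctionalModule

/-! ### Reducible morphisms -/

namespace GK

variable {G : Type v} [Group G]

theorem RightInvertible.comp {A B C : GK.{u, v} G} {P : A ⟶ B} {Q : B ⟶ C}
    (hP : RightInvertible P) (hQ : RightInvertible Q) : RightInvertible (P ≫ Q) := by
  obtain ⟨P', hP'⟩ := hP
  obtain ⟨Q', hQ'⟩ := hQ
  exact ⟨Q' ≫ P', by rw [Category.assoc, reassoc_of% hQ', hP']⟩

theorem rightInvertible_of_isIso {A B : GK.{u, v} G} (P : A ⟶ B) [IsIso P] : RightInvertible P :=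
  ⟨inv P, IsIso.hom_inv_id P⟩

theorem map_mem_levelZero {A B : GRing.{u, v} G} (f : A ⟶ B) :
    (ι G).map f ∈ levelZero ((ι G).obj A) ((ι G).obj B) :=
  AddSubgroup.subset_closure ⟨f, rfl⟩

theorem levelZero_comp_map {A B C : GRing.{u, v} G} {x : (ι G).obj A ⟶ (ι G).obj B}
    (hx : x ∈ levelZero ((ι G).obj A) ((ι G).obj B)) (f : B ⟶ C) :
    x ≫ (ι G).map f ∈ levelZero ((ι G).obj A) ((ι G).obj C) := by
  rw [levelZero_eq_closure] at hx
  induction hx using AddSubgroup.closure_induction with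
  | mem x hx =>
    obtain ⟨k, rfl⟩ := hx
    rw [← Functor.map_comp]
    exact map_mem_levelZero _
  | zero => rw [Limits.zero_comp]; exact zero_mem _
  | add x y _ _ h₁ h₂ => rw [Preadditive.add_comp]; exact add_mem h₁ h₂
  | neg x _ h => rw [Preadditive.neg_comp]; exact neg_mem h

/-- After each homomorphism `φ`, the morphism `x` can be moved to level zero by a right-invertible
homomorphism. -/
def Reducible {A B : GRing.{u, v} G} (x : (ι G).obj A ⟶ (ι G).obj B) : Prop :=
  ∀ (C : GRing.{u, v} G) (φ : B ⟶ C), ∃ (D : GRing.{u, v} G) (P : C ⟶ D),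
    RightInvertible ((ι G).map P) ∧
      x ≫ (ι G).map (φ ≫ P) ∈ levelZero ((ι G).obj A) ((ι G).obj D)

theorem rightInvertible_map_id (A : GRing.{u, v} G) : RightInvertible ((ι G).map (𝟙 A)) :=
  rightInvertible_of_isIso _

theorem reducible_map {A B : GRing.{u, v} G} (f : A ⟶ B) : Reducible ((ι G).map f) := fun C φ =>
  ⟨C, 𝟙 C, rightInvertible_map_id C, by
    rw [← Functor.map_comp]; exact map_mem_levelZero _⟩

theorem reducible_zero (A B : GRing.{u, v} G) :
    Reducible (0 : (ι G).obj A ⟶ (ι G).obj B) := fun C φ =>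
  ⟨C, 𝟙 C, rightInvertible_map_id C, by rw [Limits.zero_comp]; exact zero_mem _⟩

theorem Reducible.neg {A B : GRing.{u, v} G} {x : (ι G).obj A ⟶ (ι G).obj B}
    (hx : Reducible x) : Reducible (-x) := fun C φ => by
  obtain ⟨D, P, hP, h⟩ := hx C φ
  exact ⟨D, P, hP, by rw [Preadditive.neg_comp]; exact neg_mem h⟩

theorem rightInvertible_map_comp {A B C : GRing.{u, v} G} {f : A ⟶ B} {k : B ⟶ C}
    (hf : RightInvertible ((ι G).map f)) (hk : RightInvertible ((ι G).map k)) :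
    RightInvertible ((ι G).map (f ≫ k)) := by
  rw [Functor.map_comp]; exact hf.comp hk

theorem Reducible.add {A B : GRing.{u, v} G} {x y : (ι G).obj A ⟶ (ι G).obj B}
    (hx : Reducible x) (hy : Reducible y) : Reducible (x + y) := fun C φ => by
  obtain ⟨D, P, hP, h⟩ := hx C φ
  -- The second summand is moved after `P` has been applied, so one homomorphism serves both; the
  -- first summand stays at level 0 under the further homomorphism `P'`.
  obtain ⟨D', P', hP', h'⟩ := hy D (φ ≫ P)
  refine ⟨D', P ≫ P', rightInvertible_map_comp hP hP', ?_⟩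
  rw [Preadditive.add_comp, ← Category.assoc φ]
  refine add_mem ?_ h'
  rw [Functor.map_comp, ← Category.assoc]
  exact levelZero_comp_map h P'

/-- For a single homomorphism `f` in place of `w`, the definition is applied to `x` with `f φ`
instead of `φ`; closure under sums and signs does the rest. -/
theorem Reducible.comp_levelZero {A B C : GRing.{u, v} G} {x : (ι G).obj A ⟶ (ι G).obj B}
    (hx : Reducible x) {w : (ι G).obj B ⟶ (ι G).obj C}
    (hw : w ∈ levelZero ((ι G).obj B) ((ι G).obj C)) : Reducible (x ≫ w) := by
  rw [levelZero_eq_closure] at hw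
  induction hw using AddSubgroup.closure_induction with
  | mem w hw =>
    obtain ⟨f, rfl⟩ := hw
    intro D φ
    obtain ⟨D', P, hP, h⟩ := hx D (f ≫ φ)
    refine ⟨D', P, hP, ?_⟩
    rwa [Category.assoc, ← Functor.map_comp, ← Category.assoc]
  | zero => rw [Limits.comp_zero]; exact reducible_zero _ _
  | add w w' _ _ h₁ h₂ => rw [Preadditive.comp_add]; exact h₁.add h₂
  | neg w _ h => rw [Preadditive.comp_neg]; exact h.neg

/-- The right factor goes first: once `y φ P₁` is level 0, the product is `x` followed by a level-0
morphism. -/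
theorem Reducible.comp {A B C : GRing.{u, v} G} {x : (ι G).obj A ⟶ (ι G).obj B}
    {y : (ι G).obj B ⟶ (ι G).obj C} (hx : Reducible x) (hy : Reducible y) :
    Reducible (x ≫ y) := fun D φ => by
  obtain ⟨D₁, P₁, hP₁, h₁⟩ := hy D φ
  obtain ⟨D₂, P₂, hP₂, h₂⟩ := hx.comp_levelZero h₁ D₁ (𝟙 D₁)
  refine ⟨D₂, P₁ ≫ P₂, rightInvertible_map_comp hP₁ hP₂, ?_⟩
  rw [Category.id_comp] at h₂
  rwa [← Category.assoc φ, Functor.map_comp, ← Category.assoc, Category.assoc x y]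

theorem isIso_cornerHom {C : GRing.{u, v} G} (E : FunctionalModule C) (hE : E.Spanned) :
    IsIso ((ι G).map (E.cornerHom hE)) :=
  isIso_corner (E.isCornerEmbedding_cornerHom hE)

theorem reducible_cornerInv {A D : GRing.{u, v} G} (e : A ⟶ D) (he : IsCornerEmbedding e) :
    Reducible (cornerInv e he) := fun C φ => by
  obtain ⟨E, J, T, hcof, κ, h⟩ := id he
  let F := E.prod ((self A).prod (free A J T))
  have key := map_pushHom_eq φ (prodCoordinate E J T) hcof (e ≫ κ.hom) fun a =>
    AddMonoidHom.ext fun x => h a x.1 x.2.1 x.2.2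
  have := isIso_cornerHom (push φ F) (spanned_push φ F)
  refine ⟨_, cornerHom (push φ F) (spanned_push φ F), rightInvertible_of_isIso _, ?_⟩
  -- By `key`, the composite `φ c` equals `e` followed by a homomorphism, so `e⁻¹` cancels.
  rw [← key, Category.assoc, Functor.map_comp, ← Category.assoc, inv_comp_corner, Category.id_comp]
  exact map_mem_levelZero _

/-- After the push-forward, `φ` factors through `j` in `GK^G`, and `Δ j = 1 - f s` contains no
formal generator. The inclusion into the pushed-out ring has only a right inverse here, its own `Δ`;
this is why right-invertibility is the notion used. -/
theorem reducible_Δ {B M A : GRing.{u, v} G} (S : SplitExact B M A) :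
    Reducible (Δ S) := fun C φ => by
  have key := map_pushHom_eq φ (selfCoordinate B) (cofull_self B)
    ((selfCoordinate B).compactHom (cofull_self B)) fun a => rfl
  have := isIso_cornerHom (push φ (self B)) (spanned_push φ (self B))
  let S' := (splitAction S φ).splitExact (cofull_push φ (self B))
  refine ⟨_, cornerHom (push φ (self B)) (spanned_push φ (self B)) ≫ S'.j,
    rightInvertible_map_comp (rightInvertible_of_isIso _) ⟨Δ S', j_comp_Δ S'⟩, ?_⟩
  have e : (ι G).map (φ ≫ cornerHom (push φ (self B)) (spanned_push φ (self B)) ≫ S'.j) =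
      (ι G).map S.j ≫ (ι G).map (toSemidirect S φ) := by
    rw [← Category.assoc, Functor.map_comp, ← key, ← Functor.map_comp, ← Functor.map_comp,
      j_toSemidirect]
  rw [e, ← Category.assoc, Δ_comp_j, Preadditive.sub_comp, Category.id_comp,
    ← Functor.map_comp, ← Functor.map_comp]
  exact sub_mem (map_mem_levelZero _) (map_mem_levelZero _)

theorem reducible_mk {A B : GRing.{u, v} G} (x : GKExpr A B) :
    Reducible (A := A) (B := B) (Quot.mk _ x) := by
  induction x with
  | hom f => exact reducible_map f
  | cornerInv e he => exact reducible_cornerInv e he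
  | delta S => exact reducible_Δ S
  | comp x y hx hy => exact hx.comp hy
  | zero A B => exact reducible_zero A B
  | add x y hx hy => exact hx.add hy
  | neg x hx => exact hx.neg

/-! ### Level 0 is reached; differences and identities as extended double split exact sequences -/

theorem exists_levelZero {A B : GRing.{u, v} G} (z : (ι G).obj A ⟶ (ι G).obj B) :
    ∃ (D : GRing.{u, v} G) (P : B ⟶ D), RightInvertible ((ι G).map P) ∧
      z ≫ (ι G).map P ∈ levelZero ((ι G).obj A) ((ι G).obj D) := by
  have hz : Reducible z := by
    obtain ⟨x, rfl⟩ := Quot.exists_rep z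
    exact reducible_mk x
  obtain ⟨D, P, hP, h⟩ := hz B (𝟙 B)
  rw [Category.id_comp] at h
  exact ⟨D, P, hP, h⟩

/-- Inserting the biproduct relation between the injection of `A` and the projection to `B`
expresses this morphism as twice itself. -/
theorem map_zeroHom (A B : GRing.{u, v} G) : (ι G).map (GRing.zeroHom A B) = 0 := by
  have e₁ : A.inl B ≫ A.fst B = 𝟙 A := rfl
  have e₂ : A.inl B ≫ A.snd B = GRing.zeroHom A B := rfl
  have e₃ : A.inr B ≫ A.snd B = 𝟙 B := rfl
  have h := congrArg (fun x => (ι G).map (A.inl B) ≫ x ≫ (ι G).map (A.snd B)) (biproduct A B)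
  simp only [Preadditive.add_comp, Preadditive.comp_add, ← Functor.map_comp, Category.id_comp,
    Category.assoc, e₂, e₃] at h
  rw [← Category.assoc (A.inl B), e₁, ← Category.assoc (A.inl B), e₂, Category.comp_id,
    Category.id_comp] at h
  simpa using h

theorem isExtendedDoubleSplit_sub {A B : GRing.{u, v} G} (h k : A ⟶ B) :
    IsExtendedDoubleSplit (A := (ι G).obj A) (Z := (ι G).obj B)
      ((ι G).map h - (ι G).map k) := by
  have hE : (zeroModule B).Spanned := fun ξ => by
    rw [Subsingleton.elim ξ 0]; exact zero_mem _
  let e := cornerHom (zeroModule B) hE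
  have he : IsCornerEmbedding e := isCornerEmbedding_cornerHom _ hE
  -- An extended sequence ends with an inverse corner embedding. Both homomorphisms are composed
  -- with the corner embedding of `B` into the compact operators on `0 ⊕ B`, and its inverse then
  -- cancels it.
  refine ⟨_, _, graphDoubleSplit (h ≫ e) (k ≫ e), e, he, Eq.symm ?_⟩
  refine (congrArg (· ≫ cornerInv e he) (toGK_graphDoubleSplit (h ≫ e) (k ≫ e))).trans ?_
  change ((ι G).map (h ≫ e) - (ι G).map (k ≫ e)) ≫ cornerInv e he = _
  rw [Functor.map_comp, Functor.map_comp, ← Preadditive.sub_comp, Category.assoc, corner_comp_inv]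
  exact Category.comp_id _

theorem isExtendedDoubleSplit_id (A : GRing.{u, v} G) :
    IsExtendedDoubleSplit (𝟙 ((ι G).obj A)) := by
  have h := isExtendedDoubleSplit_sub (𝟙 A) (GRing.zeroHom A A)
  rw [map_zeroHom, sub_zero] at h
  exact h

end GK

theorem lemma97 {G : Type v} [Group G] {A B : GK.{u, v} G} (N : ℕ) (z : A ⟶ B)
    (hz : GK.IsTerm N z) :
    (∃ (D : GRing.{u, v} G) (P : B.ring ⟶ D),
      GK.RightInvertible ((GK.ι G).map P) ∧
      (2 ≤ N → GK.IsTerm (N - 1) (z ≫ (GK.ι G).map P)) ∧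
      (N = 1 → z ≫ (GK.ι G).map P ∈ GK.levelZero A ((GK.ι G).obj D))) ∧
    (∃ (D : GRing.{u, v} G) (P : B.ring ⟶ D),
      GK.RightInvertible ((GK.ι G).map P) ∧
      z ≫ (GK.ι G).map P ∈ GK.levelZero A ((GK.ι G).obj D)) := by
  obtain ⟨A⟩ := A
  obtain ⟨B⟩ := B
  obtain ⟨D, P, hP, h⟩ := GK.exists_levelZero (A := A) (B := B) z
  -- The invertible `c` is needed only for (i), where the level-0 morphism has to be a single
  -- difference.
  obtain ⟨D', c, hc, f, k, hfk⟩ := GK.exists_eq_sub_of_levelZero _ h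
  have hz' : z ≫ (GK.ι G).map (P ≫ c) = (GK.ι G).map f - (GK.ι G).map k := by
    rw [Functor.map_comp, ← hfk]
    exact (Category.assoc _ _ _).symm
  refine ⟨⟨D', P ≫ c, GK.rightInvertible_map_comp hP (GK.rightInvertible_of_isIso _),
    fun hN => ?_, fun _ => ?_⟩, D, P, hP, h⟩
  · obtain ⟨n, rfl⟩ : ∃ n, N = n + 2 := ⟨N - 2, by omega⟩
    refine .pos ?_
    rw [hz']
    exact GK.isWord_succ (GK.isExtendedDoubleSplit_sub f k) (GK.isExtendedDoubleSplit_id D') n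
  · rw [hz']
    exact sub_mem (GK.map_mem_levelZero f) (GK.map_mem_levelZero k)
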